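/- Let $R$ be a commutative noetherian ring, let $C$ be a semidualizing $R$-module (that is, $C$ is finitely generated, the homothety map $R\to\operatorname{Hom}_R(C,C)$ is an isomorphism, and $\operatorname{Ext}^i_R(C,C)=0$ for all $i\ge 1$), and let $M$ be an $R$-module. For a class $\mathcal X$ of $R$-modules, an augmented proper $\mathcal X$-resolution of an $R$-module $N$ is a complex $X^+=(\cdots\to X_1\to X_0\to N\to 0)$ with every $X_i\in\mathcal X$ such that $\operatorname{Hom}_R(Y,X^+)$ is exact for every $Y\in\mathcal X$ (the complex $X^+$ itself need not be exact). The $\mathcal X$-projective dimension of $N$ is $$\mathcal X\text{-}\mathrm{pd}_R(N)=\inf\{\sup\{n\ge 0\mid X_n\ne 0\}\mid X^+\text{ is an augmented proper }\mathcal X\text{-resolution of }N\}\in\{-\infty\}\cup\mathbb N\cup\{\infty\},$$ where $\sup\emptyset=-\infty$ and $\inf\emptyset=\infty$. Write $\mathrm{fd}_R(N)$ for this dimension when $\mathcal X$ is the class of flat $R$-modules. Call an $R$-module $C$-flat if it is isomorphic to $F\otimes_R C$ for some flat $R$-module $F$, and write $\mathcal F_C\text{-}\mathrm{pd}_R(N)$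 for this dimension when $\mathcal X$ is the class of $C$-flat $R$-modules. Then the following hold. (a) For every integer $n\ge 0$, one has $\mathcal F_C\text{-}\mathrm{pd}_R(M)\le n$ if and only if there is an exact sequence $$0\to L_n\to\cdots\to L_0\to M\to 0$$ in which every $L_i$ is $C$-flat. (b) $\mathcal F_C\text{-}\mathrm{pd}_R(M)=\mathrm{fd}_R(\operatorname{Hom}_R(C,M))$. (c) $\mathcal F_C\text{-}\mathrm{pd}_R(C\otimes_R M)=\mathrm{fd}_R(M)$. -/

import Mathlib

open scoped TensorProduct

universe u

/-- A finitely generated module `C` over a commutative ring `R` is semidualizing if the homothety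
map `R → Hom_R(C, C)`, `r ↦ (c ↦ r • c)`, is an isomorphism and `Ext^i_R(C, C) = 0` for `i ≥ 1`. -/
structure IsSemidualizing (R : Type u) [CommRing R] (C : Type u) [AddCommGroup C] [Module R C] :
    Prop where
  finite : Module.Finite R C
  bijective_homothety : Function.Bijective (LinearMap.lsmul R C)
  subsingleton_ext : ∀ i : ℕ, 1 ≤ i →
    Subsingleton (CategoryTheory.Abelian.Ext (ModuleCat.of R C) (ModuleCat.of R C) i)

/-- The class of flat `R`-modules. -/
def flatModules (R : Type u) [CommRing R] : CategoryTheory.ObjectProperty (ModuleCat.{u} R) :=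
  fun N => Module.Flat R N

/-- The class of `C`-flat `R`-modules: those isomorphic to `F ⊗ C` for some flat module `F`. -/
def cFlatModules (R : Type u) [CommRing R] (C : Type u) [AddCommGroup C] [Module R C] :
    CategoryTheory.ObjectProperty (ModuleCat.{u} R) :=
  fun N => ∃ F : ModuleCat.{u} R, Module.Flat R F ∧ Nonempty (N ≃ₗ[R] F ⊗[R] C)

/-- An augmented complex `⋯ → X₂ → X₁ → X₀ → M → 0` of `R`-modules. -/
structure AugmentedComplex (R : Type u) [CommRing R] (M : Type u) [AddCommGroup M]
    [Module R M] where
  X : ℕ → ModuleCat.{u} R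
  d : ∀ i : ℕ, X (i + 1) →ₗ[R] X i
  aug : X 0 →ₗ[R] M
  d_comp_d : ∀ i : ℕ, d i ∘ₗ d (i + 1) = 0
  aug_comp_d : aug ∘ₗ d 0 = 0

namespace AugmentedComplex

variable {R : Type u} [CommRing R] {M : Type u} [AddCommGroup M] [Module R M]

/-- The augmented complex `⋯ → X₁ → X₀ → M → 0` is exact. -/
structure IsExact (A : AugmentedComplex R M) : Prop where
  surjective_aug : Function.Surjective A.aug
  exact_zero : Function.Exact (A.d 0) A.aug
  exact_succ : ∀ i : ℕ, Function.Exact (A.d (i + 1)) (A.d i)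

/-- For an `R`-module `Y`, the complex
`⋯ → Hom(Y, X₁) → Hom(Y, X₀) → Hom(Y, M) → 0` is exact. -/
structure IsHomExact (A : AugmentedComplex R M) (Y : ModuleCat.{u} R) : Prop where
  surjective_aug : Function.Surjective (fun f : Y →ₗ[R] A.X 0 => A.aug ∘ₗ f)
  exact_zero : Function.Exact (fun f : Y →ₗ[R] A.X 1 => A.d 0 ∘ₗ f)
    (fun f : Y →ₗ[R] A.X 0 => A.aug ∘ₗ f)
  exact_succ : ∀ i : ℕ, Function.Exact (fun f : Y →ₗ[R] A.X (i + 2) => A.d (i + 1) ∘ₗ f)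
    (fun f : Y →ₗ[R] A.X (i + 1) => A.d i ∘ₗ f)

/-- The augmented complex is an augmented proper `𝒳`-resolution of `M`: every `Xᵢ` is in `𝒳`, and
`Hom(Y, -)` makes the augmented complex exact for every `Y` in `𝒳`. (The augmented complex itself
need not be exact.) -/
structure IsProperResolution (A : AugmentedComplex R M)
    (𝒳 : CategoryTheory.ObjectProperty (ModuleCat.{u} R)) : Prop where
  mem : ∀ i : ℕ, 𝒳 (A.X i)
  isHomExact : ∀ Y : ModuleCat.{u} R, 𝒳 Y → A.IsHomExact Y

/-- `sup {n | Xₙ ≠ 0}`, where the supremum of the empty set is `⊥ = -∞`. -/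
noncomputable def length (A : AugmentedComplex R M) : WithBot ℕ∞ :=
  ⨆ (n : ℕ) (_ : Nontrivial (A.X n)), (n : WithBot ℕ∞)

end AugmentedComplex

/-- The `𝒳`-projective dimension of `M`: the infimum of the lengths of the proper `𝒳`-resolutions
of `M`, with values in `{-∞} ∪ ℕ ∪ {∞}`. -/
noncomputable def relProjDim {R : Type u} [CommRing R]
    (𝒳 : CategoryTheory.ObjectProperty (ModuleCat.{u} R))
    (M : Type u) [AddCommGroup M] [Module R M] : WithBot ℕ∞ :=
  ⨅ (A : AugmentedComplex R M) (_ : A.IsProperResolution 𝒳), A.length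

/-- The flat dimension of `M`, i.e. the relative dimension for the class of flat modules. -/
noncomputable def flatDim (R : Type u) [CommRing R]
    (M : Type u) [AddCommGroup M] [Module R M] : WithBot ℕ∞ :=
  relProjDim (flatModules R) M

/-- The `𝓕_C`-projective dimension of `M`, i.e. the relative dimension for the class of
`C`-flat modules. -/
noncomputable def cFlatProjDim (R : Type u) [CommRing R] (C : Type u) [AddCommGroup C] [Module R C]
    (M : Type u) [AddCommGroup M] [Module R M] : WithBot ℕ∞ :=
  relProjDim (cFlatModules R C) M

/-! The functors `- ⊗ C` and `Hom(C, -)` are adjoint, and for flat `F` the unit `F → Hom(C, F ⊗ C)`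
is bijective: it is tensor evaluation on `F ⊗ Hom(C, C)`, an isomorphism because `C` is finite, `R`
noetherian and `F` flat, combined with `Hom(C, C) = R`. Hence the two functors carry proper flat
resolutions of `Hom(C, M)` and proper `C`-flat resolutions of `M` to each other without creating new
nonzero terms. This gives (b), with no finiteness of dimensions involved
(`cFlatProjDim_eq_flatDim_hom`).

For (a), flat dimension has to be read off from exact resolutions. A proper flat resolution is
exact, as testing on `R` shows. Conversely, over a noetherian ring a flat module embeds in its
double character module, which is flat and cotorsion, with flat cokernel. Pushouts along such
embeddings turn a bounded exact flat resolution into one with cotorsion kernels, along which maps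
from flat modules lift (`HasResolution.exists_cotorsion_kernel`). What remains is a Foxby-type
equivalence. If `N` has a finite flat resolution, tensoring it with `C` keeps it exact, the unit at
`N` is bijective and the positive Ext modules from `C` to `N ⊗ C` vanish
(`HasResolution.auslander`). In the other direction `Hom(C, -)` keeps finite `C`-flat resolutions
exact (`HasResolution.hom`). The evaluation `Hom(C, M) ⊗ C → M` is then bijective because `Hom(C, Z)
= 0` forces `Z = 0`, `C` being finite and faithful.

For (c), by (b) it suffices to compare `Hom(C, M ⊗ C)` with `M`. If either has finite flat
dimension, the unit at `M` is bijective; otherwise both dimensions are infinite. -/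

open CategoryTheory

/-! ### Long exact Ext sequences and dimension shifting. -/

section ExtVanishing

variable {R : Type u} [CommRing R]

/-- All positive `Ext`-modules from `A` to `B` vanish. -/
def ExtVanish (R : Type u) [CommRing R] (A B : Type u) [AddCommGroup A] [Module R A]
    [AddCommGroup B] [Module R B] : Prop :=
  ∀ i : ℕ, Subsingleton (Abelian.Ext (ModuleCat.of R A) (ModuleCat.of R B) (i + 1))

variable {A B D X : Type u} [AddCommGroup A] [Module R A] [AddCommGroup B] [Module R B]
  [AddCommGroup D] [Module R D] [AddCommGroup X] [Module R X]

/-- The short complex of module categories attached to an exact pair of linear maps. -/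
abbrev moduleShortComplex (f : A →ₗ[R] B) (g : B →ₗ[R] D) (h : Function.Exact f g) :
    ShortComplex (ModuleCat.{u} R) :=
  ShortComplex.mk (ModuleCat.ofHom f) (ModuleCat.ofHom g) (by
    ext x
    exact h.apply_apply_eq_zero x)

lemma moduleShortComplex_shortExact {f : A →ₗ[R] B} {g : B →ₗ[R] D}
    (hf : Function.Injective f) (h : Function.Exact f g) (hg : Function.Surjective g) :
    (moduleShortComplex f g h).ShortExact where
  exact := (ShortComplex.ShortExact.moduleCat_exact_iff_function_exact _).2 h
  mono_f := (ModuleCat.mono_iff_injective _).2 hf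
  epi_g := (ModuleCat.epi_iff_surjective _).2 hg

lemma ExtVanish.of_projective [Module.Projective R A] : ExtVanish R A B := fun i => by
  have : Projective (ModuleCat.of R A) := (IsProjective.iff_projective A).1 inferInstance
  exact Abelian.Ext.subsingleton_of_projective _ _ _

lemma ExtVanish.of_equiv_right (h : ExtVanish R X A) (e : A ≃ₗ[R] B) : ExtVanish R X B := by
  intro i
  have := h i
  have e' : ModuleCat.of R A ≅ ModuleCat.of R B := e.toModuleIso
  refine subsingleton_of_forall_eq 0 fun y => ?_
  have h0 : y.comp (Abelian.Ext.mk₀ e'.inv) (add_zero (i + 1)) = 0 := Subsingleton.elim _ _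
  have h1 : (y.comp (Abelian.Ext.mk₀ e'.inv) (add_zero (i + 1))).comp
      (Abelian.Ext.mk₀ e'.hom) (add_zero (i + 1)) = y := by
    rw [Abelian.Ext.comp_assoc_of_third_deg_zero]
    simp
  rw [← h1, h0, Abelian.Ext.zero_comp]

variable {f : A →ₗ[R] B} {g : B →ₗ[R] D}

/-- Maps to the quotient lift when the first `Ext` into the kernel vanishes. -/
lemma exists_lift_of_subsingleton_ext (hf : Function.Injective f) (h : Function.Exact f g)
    (hg : Function.Surjective g)
    (hX : Subsingleton (Abelian.Ext (ModuleCat.of R X) (ModuleCat.of R A) 1))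
    (φ : X →ₗ[R] D) : ∃ ψ : X →ₗ[R] B, g ∘ₗ ψ = φ := by
  obtain ⟨x, hx⟩ := Abelian.Ext.covariant_sequence_exact₃ (ModuleCat.of R X)
    (moduleShortComplex_shortExact hf h hg) (Abelian.Ext.mk₀ (ModuleCat.ofHom φ)) (zero_add 1)
    (hX.elim _ _)
  obtain ⟨ψ, rfl⟩ := Abelian.Ext.addEquiv₀.symm.surjective x
  have hψ : Abelian.Ext.mk₀ (ψ ≫ ModuleCat.ofHom g) = Abelian.Ext.mk₀ (ModuleCat.ofHom φ) := by
    rw [← hx, ← Abelian.Ext.mk₀_comp_mk₀]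
    rfl
  have := (Abelian.Ext.mk₀_bijective _ _).1 hψ
  exact ⟨ψ.hom, by simpa using congrArg ModuleCat.Hom.hom this⟩

/-- Maps from the submodule extend when the first `Ext` out of the quotient vanishes. -/
lemma exists_extension_of_subsingleton_ext (hf : Function.Injective f) (h : Function.Exact f g)
    (hg : Function.Surjective g)
    (hX : Subsingleton (Abelian.Ext (ModuleCat.of R D) (ModuleCat.of R X) 1))
    (φ : A →ₗ[R] X) : ∃ ψ : B →ₗ[R] X, ψ ∘ₗ f = φ := by
  obtain ⟨x, hx⟩ := Abelian.Ext.contravariant_sequence_exact₁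
    (moduleShortComplex_shortExact hf h hg) (ModuleCat.of R X)
    (Abelian.Ext.mk₀ (ModuleCat.ofHom φ)) (add_zero 1)
    (hX.elim _ _)
  obtain ⟨ψ, rfl⟩ := Abelian.Ext.addEquiv₀.symm.surjective x
  have hψ : Abelian.Ext.mk₀ (ModuleCat.ofHom f ≫ ψ) = Abelian.Ext.mk₀ (ModuleCat.ofHom φ) := by
    rw [← hx, ← Abelian.Ext.mk₀_comp_mk₀]
    rfl
  have := (Abelian.Ext.mk₀_bijective _ _).1 hψ
  exact ⟨ψ.hom, by simpa using congrArg ModuleCat.Hom.hom this⟩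

/-- In the long exact sequence, `Ext^i(X, D)` sits between `Ext^i(X, B)` and `Ext^(i+1)(X, A)`. -/
lemma ExtVanish.cokernel (hf : Function.Injective f) (h : Function.Exact f g)
    (hg : Function.Surjective g) (hA : ExtVanish R X A) (hB : ExtVanish R X B) :
    ExtVanish R X D := fun i => by
  refine subsingleton_of_forall_eq 0 fun x => ?_
  obtain ⟨y, rfl⟩ := Abelian.Ext.covariant_sequence_exact₃ (ModuleCat.of R X)
    (moduleShortComplex_shortExact hf h hg) x rfl ((hA (i + 1)).elim _ _)
  rw [(hB i).elim y 0, Abelian.Ext.zero_comp]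

/-- Dimension shifting: `Ext` out of a syzygy. -/
lemma subsingleton_ext_syzygy [Module.Projective R B] (hf : Function.Injective f)
    (h : Function.Exact f g) (hg : Function.Surjective g) {i : ℕ}
    (hD : Subsingleton (Abelian.Ext (ModuleCat.of R D) (ModuleCat.of R X) (i + 2))) :
    Subsingleton (Abelian.Ext (ModuleCat.of R A) (ModuleCat.of R X) (i + 1)) := by
  refine subsingleton_of_forall_eq 0 fun x => ?_
  obtain ⟨y, rfl⟩ := Abelian.Ext.contravariant_sequence_exact₁
    (moduleShortComplex_shortExact hf h hg) (ModuleCat.of R X) x (n₁ := i + 2) (by lia)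
    (hD.elim _ _)
  rw [(ExtVanish.of_projective (B := X) i).elim y 0, Abelian.Ext.comp_zero]

lemma subsingleton_ext_of_syzygy [Module.Projective R B] (hf : Function.Injective f)
    (h : Function.Exact f g) (hg : Function.Surjective g) {i : ℕ}
    (hA : Subsingleton (Abelian.Ext (ModuleCat.of R A) (ModuleCat.of R X) (i + 1))) :
    Subsingleton (Abelian.Ext (ModuleCat.of R D) (ModuleCat.of R X) (i + 2)) := by
  refine subsingleton_of_forall_eq 0 fun x => ?_
  obtain ⟨y, rfl⟩ := Abelian.Ext.contravariant_sequence_exact₃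
    (moduleShortComplex_shortExact hf h hg) (ModuleCat.of R X) x
    ((ExtVanish.of_projective (B := X) (i + 1)).elim _ _) (n₀ := i + 1) (by lia)
  rw [hA.elim y 0, Abelian.Ext.comp_zero]

/-- Since `B` is projective, every class in `Ext^1(D, X)` is the connecting image of a map `A → X`;
the image of a map that extends to `B` is zero. -/
lemma subsingleton_ext_one_of_extension [Module.Projective R B] (hf : Function.Injective f)
    (h : Function.Exact f g) (hg : Function.Surjective g)
    (hA : ∀ φ : A →ₗ[R] X, ∃ ψ : B →ₗ[R] X, ψ ∘ₗ f = φ) :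
    Subsingleton (Abelian.Ext (ModuleCat.of R D) (ModuleCat.of R X) 1) := by
  refine subsingleton_of_forall_eq 0 fun x => ?_
  have hS := moduleShortComplex_shortExact hf h hg
  obtain ⟨y, rfl⟩ := Abelian.Ext.contravariant_sequence_exact₃ hS (ModuleCat.of R X) x
    ((ExtVanish.of_projective (B := X) 0).elim _ _) (n₀ := 0) (by lia)
  obtain ⟨φ, rfl⟩ := Abelian.Ext.addEquiv₀.symm.surjective y
  obtain ⟨ψ, hψ⟩ := hA φ.hom
  have hφ : φ = ModuleCat.ofHom f ≫ ModuleCat.ofHom ψ := by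
    ext x
    exact (LinearMap.congr_fun hψ x).symm
  have : Abelian.Ext.addEquiv₀.symm φ =
      (Abelian.Ext.mk₀ (ModuleCat.ofHom f)).comp (Abelian.Ext.mk₀ (ModuleCat.ofHom ψ))
        (zero_add 0) := by
    rw [Abelian.Ext.mk₀_comp_mk₀, ← hφ]
    rfl
  rw [this]
  exact hS.extClass_comp_assoc _

end ExtVanishing

/-! ### Character modules and flatness. -/

section Characters

variable {R : Type u} [CommRing R]
variable {A B D : Type u} [AddCommGroup A] [Module R A] [AddCommGroup B] [Module R B]
  [AddCommGroup D] [Module R D]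

lemma CharacterModule.dual_exact {f : A →ₗ[R] B} {g : B →ₗ[R] D} (h : Function.Exact f g) :
    Function.Exact (CharacterModule.dual g) (CharacterModule.dual f) := by
  intro φ
  constructor
  · intro hφ
    have hker : (g.rangeRestrict.toAddMonoidHom).ker ≤ AddMonoidHom.ker φ := by
      intro b hb
      have hb' : g b = 0 := by simpa using congrArg Subtype.val hb
      obtain ⟨a, rfl⟩ := (h b).1 hb'
      exact DFunLike.congr_fun hφ a
    let φ' : CharacterModule (LinearMap.range g) :=
      AddMonoidHom.liftOfSurjective g.rangeRestrict.toAddMonoidHom g.surjective_rangeRestrict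
        ⟨φ, hker⟩
    obtain ⟨ψ, hψ⟩ := CharacterModule.dual_surjective_of_injective _
      (LinearMap.range g).injective_subtype φ'
    refine ⟨ψ, CharacterModule.ext _ fun b => ?_⟩
    have h1 : ψ (g b) = φ' (g.rangeRestrict b) :=
      DFunLike.congr_fun hψ (g.rangeRestrict b)
    have h2 : φ' (g.rangeRestrict b) = φ b :=
      AddMonoidHom.liftOfRightInverse_comp_apply g.rangeRestrict.toAddMonoidHom _ _ ⟨φ, hker⟩ b
    exact h1.trans h2
  · rintro ⟨ψ, rfl⟩
    refine CharacterModule.ext _ fun a => ?_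
    change ψ (g (f a)) = 0
    rw [h.apply_apply_eq_zero, map_zero]

/-- A linear map into a Baer module extends along any linear map with smaller kernel. -/
lemma Module.Baer.exists_comp_eq {Q : Type u} [AddCommGroup Q] [Module R Q]
    (hQ : Module.Baer R Q) (f : A →ₗ[R] B) (g : A →ₗ[R] Q)
    (h : LinearMap.ker f ≤ LinearMap.ker g) : ∃ φ : B →ₗ[R] Q, φ ∘ₗ f = g := by
  obtain ⟨φ, hφ⟩ := Module.Baer.extension_property hQ
    ((LinearMap.ker f).liftQ f le_rfl)
    (LinearMap.ker_eq_bot.1 (Submodule.ker_liftQ_eq_bot _ _ _ le_rfl))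
    ((LinearMap.ker f).liftQ g h)
  refine ⟨φ, LinearMap.ext fun a => ?_⟩
  simpa using LinearMap.congr_fun hφ (Submodule.Quotient.mk a)

lemma Module.Baer.of_retract {Q Q' : Type u} [AddCommGroup Q] [Module R Q]
    [AddCommGroup Q'] [Module R Q'] (hQ : Module.Baer R Q) (i : Q' →ₗ[R] Q) (r : Q →ₗ[R] Q')
    (hr : r ∘ₗ i = LinearMap.id) : Module.Baer R Q' := by
  intro I φ
  obtain ⟨ψ, hψ⟩ := hQ I (i ∘ₗ φ)
  refine ⟨r ∘ₗ ψ, fun x hx => ?_⟩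
  simpa [hψ x hx] using LinearMap.congr_fun hr (φ ⟨x, hx⟩)

/-- Over a noetherian ring the character module of an injective module is flat. -/
lemma CharacterModule.flat_of_baer [IsNoetherianRing R] {E : Type u} [AddCommGroup E] [Module R E]
    (hE : Module.Baer R E) : Module.Flat R (CharacterModule E) := by
  refine Module.Flat.of_forall_isTrivialRelation fun {l f x} hx => ?_
  -- Finitely many syzygies `v j` of `f` suffice because `R` is noetherian. Applying `Hom(-, E)` to
  -- `R^k → R^l → R` gives `E → E^l → E^k`, the maps `β` and `α` below, exact in the middle because
  -- `E` is injective.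
  obtain ⟨k, v, hv⟩ := Submodule.fg_iff_exists_fin_generating_family.1
    (IsNoetherian.noetherian (LinearMap.ker (Fintype.linearCombination R f)))
  let α : (Fin l → E) →ₗ[R] (Fin k → E) :=
    LinearMap.pi fun j => ∑ i, v j i • LinearMap.proj i
  let β : E →ₗ[R] (Fin l → E) := LinearMap.pi fun i => f i • LinearMap.id
  have hvK : ∀ j, ∑ i, v j i * f i = 0 := fun j => by
    have : v j ∈ LinearMap.ker (Fintype.linearCombination R f) := by
      rw [← hv]; exact Submodule.subset_span ⟨j, rfl⟩
    simpa [Fintype.linearCombination_apply] using this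
  have hβα : Function.Exact β α := by
    intro e
    constructor
    · intro he
      obtain ⟨h, hh⟩ := hE.exists_comp_eq (Fintype.linearCombination R f)
        (Fintype.linearCombination R e) (by
          rw [← hv, Submodule.span_le]
          rintro _ ⟨j, rfl⟩
          simpa [α, Fintype.linearCombination_apply] using congrFun he j)
      refine ⟨h 1, funext fun i => ?_⟩
      have := LinearMap.congr_fun hh (Pi.single i 1)
      simp only [LinearMap.comp_apply, Fintype.linearCombination_apply_single, one_smul] at this
      simp only [β, LinearMap.pi_apply, LinearMap.smul_apply, LinearMap.id_apply]
      rw [← this, ← map_smul, smul_eq_mul, mul_one]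
    · rintro ⟨e, rfl⟩
      funext j
      simp only [α, β, LinearMap.pi_apply, LinearMap.sum_apply, LinearMap.smul_apply,
        LinearMap.proj_apply, LinearMap.id_apply, ← mul_smul, ← Finset.sum_smul, hvK, zero_smul]
      rfl
  let Φ : CharacterModule (Fin l → E) :=
    ∑ i, CharacterModule.dual (LinearMap.proj (R := R) (φ := fun _ => E) i) (x i)
  have hΦapp : ∀ e, Φ e = ∑ i, x i (e i) := fun e => by
    exact AddMonoidHom.finsetSum_apply _ _ _
  have hΦ : CharacterModule.dual β Φ = 0 := by
    refine CharacterModule.ext _ fun e => ?_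
    change Φ (β e) = 0
    rw [hΦapp]
    have h1 := DFunLike.congr_fun hx e
    have h2 : (∑ i, f i • x i) e = ∑ i, (f i • x i) e := AddMonoidHom.finsetSum_apply _ _ _
    rw [h2] at h1
    have h3 : (0 : CharacterModule E) e = 0 := rfl
    rw [h3] at h1
    simpa [β] using h1
  -- The relation says that `x`, viewed as a character `Φ` of `E^l`, is killed by the dual of `β`;
  -- so it comes from a character of `E^k`, whose components trivialize the relation.
  obtain ⟨Ψ, hΨ⟩ := (CharacterModule.dual_exact hβα Φ).1 hΦ
  refine ⟨k, fun i j => v j i, fun j => CharacterModule.dual (LinearMap.single R (fun _ => E) j) Ψ,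
    fun i => CharacterModule.ext _ fun e => ?_, fun j => by
      simpa [mul_comm] using hvK j⟩
  have h1 : x i e = Φ (Pi.single i e) := by
    rw [hΦapp, Finset.sum_eq_single i]
    · simp
    · intro b _ hb; simp [Pi.single_eq_of_ne hb]
    · simp
  have h2 : Φ (Pi.single i e) = Ψ (α (Pi.single i e)) :=
    (DFunLike.congr_fun hΨ (Pi.single i e)).symm
  have h3 : α (Pi.single i e) = ∑ j, Pi.single j (v j i • e) := by
    funext j
    simp only [α, LinearMap.pi_apply, LinearMap.sum_apply, LinearMap.smul_apply,
      LinearMap.proj_apply, Finset.sum_apply, Finset.sum_pi_single, Finset.mem_univ, if_true]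
    rw [Finset.sum_eq_single i]
    · simp
    · intro b _ hb; simp [Pi.single_eq_of_ne hb]
    · simp
  have h4 : (∑ j, v j i • CharacterModule.dual (LinearMap.single R (fun _ => E) j) Ψ) e =
      ∑ j, (v j i • CharacterModule.dual (LinearMap.single R (fun _ => E) j) Ψ) e :=
    AddMonoidHom.finsetSum_apply _ _ _
  rw [h1, h2, h3, map_sum]
  exact h4.symm

/-- The evaluation map to the double character module. -/
noncomputable def CharacterModule.eval (R : Type u) [CommRing R] (A : Type u) [AddCommGroup A]
    [Module R A] : A →ₗ[R] CharacterModule (CharacterModule A) where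
  toFun a := (AddMonoidHom.eval a : (A →+ AddCircle (1 : ℚ)) →+ AddCircle (1 : ℚ))
  map_add' a b := CharacterModule.ext _ fun φ => map_add φ a b
  map_smul' _ _ := CharacterModule.ext _ fun _ => rfl

lemma CharacterModule.eval_injective : Function.Injective (CharacterModule.eval R A) := by
  rw [injective_iff_map_eq_zero]
  intro a ha
  exact CharacterModule.eq_zero_of_character_apply fun c => DFunLike.congr_fun ha c

lemma CharacterModule.flat_double [IsNoetherianRing R] [Module.Flat R A] :
    Module.Flat R (CharacterModule (CharacterModule A)) :=
  CharacterModule.flat_of_baer (Module.Flat.iff_characterModule_baer.1 inferInstance)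

variable {f : A →ₗ[R] B} {g : B →ₗ[R] D}

/-- Evaluation on the character module of `A` splits the dual of evaluation on `A`. So the character
module of the quotient is a retract of an injective module. -/
lemma CharacterModule.flat_double_quotient [IsNoetherianRing R] [Module.Flat R A] :
    Module.Flat R (CharacterModule (CharacterModule A) ⧸
      LinearMap.range (CharacterModule.eval R A)) := by
  have hflat : Module.Flat R (CharacterModule (CharacterModule A)) := CharacterModule.flat_double
  rw [Module.Flat.iff_characterModule_baer] at hflat ⊢
  have hex := CharacterModule.dual_exact
    (LinearMap.exact_map_mkQ_range (R := R) (CharacterModule.eval R A))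
  have hinj := CharacterModule.dual_injective_of_surjective
    (LinearMap.range (CharacterModule.eval R A)).mkQ (Submodule.mkQ_surjective _)
  have hsurj := CharacterModule.dual_surjective_of_injective
    (CharacterModule.eval R A) CharacterModule.eval_injective
  obtain ⟨r, hr⟩ := ((hex.split_tfae hinj hsurj).out 0 1 rfl rfl).1
    ⟨CharacterModule.eval R (CharacterModule A), rfl⟩
  exact hflat.of_retract _ r hr

/-- The dual of an injection with flat cokernel splits. -/
lemma exists_section_dual (hf : Function.Injective f) (h : Function.Exact f g)
    (hg : Function.Surjective g) [hD : Module.Flat R D] :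
    ∃ s : CharacterModule A →ₗ[R] CharacterModule B,
      CharacterModule.dual f ∘ₗ s = LinearMap.id := by
  have hinj := CharacterModule.dual_injective_of_surjective g hg
  -- The character module of the flat module `D` is injective, so the dual sequence splits.
  refine (((CharacterModule.dual_exact h).split_tfae hinj
    (CharacterModule.dual_surjective_of_injective f hf)).out 0 1).2 ?_
  exact (Module.Flat.iff_characterModule_baer.1 hD).exists_comp_eq _ _
    (by rw [LinearMap.ker_eq_bot.2 hinj]; exact bot_le)

/-- An injection with flat cokernel stays injective after tensoring. -/
lemma rTensor_injective_of_flat_cokernel (X : Type u) [AddCommGroup X] [Module R X]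
    (hf : Function.Injective f) (h : Function.Exact f g)
    (hg : Function.Surjective g) [hD : Module.Flat R D] :
    Function.Injective (f.rTensor X) := by
  obtain ⟨s, hs⟩ := exists_section_dual hf h hg
  -- By adjunction, the dual of `X ⊗ f` is composition of maps from `X` with the dual of `f`, which
  -- has a section.
  rw [← LinearMap.lTensor_inj_iff_rTensor_inj, ← CharacterModule.dual_surjective_iff_injective]
  intro φ
  obtain ⟨φ, rfl⟩ := CharacterModule.homEquiv.surjective φ
  refine ⟨CharacterModule.homEquiv (s ∘ₗ φ), ?_⟩
  refine CharacterModule.homEquiv.symm.injective ?_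
  rw [LinearEquiv.symm_apply_apply]
  refine LinearMap.ext fun x => CharacterModule.ext _ fun a => ?_
  exact DFunLike.congr_fun (LinearMap.congr_fun hs (φ x)) a

lemma exists_extension_characterModule (X : Type u) [AddCommGroup X] [Module R X]
    (hf : Function.Injective f) (h : Function.Exact f g)
    (hg : Function.Surjective g) [Module.Flat R D] (φ : A →ₗ[R] CharacterModule X) :
    ∃ ψ : B →ₗ[R] CharacterModule X, ψ ∘ₗ f = φ :=
  rTensor_injective_iff_lcomp_surjective.1 (rTensor_injective_of_flat_cokernel X hf h hg) φ

lemma flat_of_flat_cokernel (hf : Function.Injective f) (h : Function.Exact f g)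
    (hg : Function.Surjective g) [Module.Flat R D] [Module.Flat R B] : Module.Flat R A := by
  rw [Module.Flat.iff_lTensor_preserves_injective_linearMap]
  intro N N' _ _ _ _ i hi
  have h1 : Function.Injective (LinearMap.lTensor B i ∘ₗ LinearMap.rTensor N f) :=
    (Module.Flat.lTensor_preserves_injective_linearMap i hi).comp
      (rTensor_injective_of_flat_cokernel N hf h hg)
  rw [LinearMap.lTensor_comp_rTensor, ← LinearMap.rTensor_comp_lTensor] at h1
  exact Function.Injective.of_comp h1

lemma flat_of_flat_extension (h : Function.Exact f g) (hf : Function.Injective f)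
    (hg : Function.Surjective g) [Module.Flat R A] [Module.Flat R D] : Module.Flat R B := by
  rw [Module.Flat.iff_lTensor_preserves_injective_linearMap]
  intro N N' _ _ _ _ i hi
  rw [injective_iff_map_eq_zero]
  intro x hx
  have h1 : g.rTensor N x = 0 := by
    refine Module.Flat.lTensor_preserves_injective_linearMap (M := D) i hi ?_
    rw [map_zero, ← LinearMap.comp_apply, LinearMap.lTensor_comp_rTensor,
      ← LinearMap.rTensor_comp_lTensor, LinearMap.comp_apply, hx, map_zero]
  obtain ⟨y, rfl⟩ := (rTensor_exact N h hg x).1 h1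
  have h2 : i.lTensor A y = 0 := by
    refine rTensor_injective_of_flat_cokernel N' hf h hg ?_
    rw [map_zero, ← LinearMap.comp_apply, LinearMap.rTensor_comp_lTensor,
      ← LinearMap.lTensor_comp_rTensor, LinearMap.comp_apply, hx]
  rw [Module.Flat.lTensor_preserves_injective_linearMap (M := A) i hi
    (h2.trans (map_zero _).symm), map_zero]

end Characters

/-! ### Cotorsion modules. -/

section Cotorsion

variable {R : Type u} [CommRing R]

/-- Modules into which all higher extensions from flat modules vanish. -/
def IsFlatCotorsion (R : Type u) [CommRing R] (K : Type u) [AddCommGroup K] [Module R K] : Prop :=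
  ∀ (F : Type u) [AddCommGroup F] [Module R F], Module.Flat R F → ExtVanish R F K

/-- In degree one, a map from the syzygy of a flat module to a character module extends to the free
cover. That syzygy is again flat, so dimension shifting reaches all higher degrees. -/
lemma isFlatCotorsion_characterModule (X : Type u) [AddCommGroup X] [Module R X] :
    IsFlatCotorsion R (CharacterModule X) := by
  intro F _ _ hF i
  induction i generalizing F with
  | zero =>
    have hg : Function.Surjective (Finsupp.linearCombination R (id : F → F)) :=
      Finsupp.linearCombination_id_surjective R F
    exact subsingleton_ext_one_of_extension (Submodule.injective_subtype _)
      (LinearMap.exact_subtype_ker_map _) hg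
      (exists_extension_characterModule X (Submodule.injective_subtype _)
        (LinearMap.exact_subtype_ker_map _) hg)
  | succ i ih =>
    have hg : Function.Surjective (Finsupp.linearCombination R (id : F → F)) :=
      Finsupp.linearCombination_id_surjective R F
    exact subsingleton_ext_of_syzygy (Submodule.injective_subtype _)
      (LinearMap.exact_subtype_ker_map _) hg
      (ih _ (flat_of_flat_cokernel (Submodule.injective_subtype _)
        (LinearMap.exact_subtype_ker_map _) hg))

end Cotorsion

/-! ### Finite resolutions and cotorsion kernels. -/

section Resolutions

variable {R : Type u} [CommRing R]

/-- Pushout of an extension along an injection: the new extension of `N` by `K'` contains `F` with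
quotient `Q`. -/
lemma exists_pushout_extension {K F N K' Q : Type u} [AddCommGroup K] [Module R K]
    [AddCommGroup F] [Module R F] [AddCommGroup N] [Module R N] [AddCommGroup K'] [Module R K']
    [AddCommGroup Q] [Module R Q] {i : K →ₗ[R] F} {p : F →ₗ[R] N} {j : K →ₗ[R] K'}
    {q : K' →ₗ[R] Q} (hi : Function.Injective i) (hip : Function.Exact i p)
    (hp : Function.Surjective p) (hj : Function.Injective j) (hjq : Function.Exact j q)
    (hq : Function.Surjective q) :
    ∃ (F' : ModuleCat.{u} R) (i' : K' →ₗ[R] F') (p' : F' →ₗ[R] N) (j' : F →ₗ[R] F')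
      (q' : F' →ₗ[R] Q),
      Function.Injective i' ∧ Function.Exact i' p' ∧ Function.Surjective p' ∧
      Function.Injective j' ∧ Function.Exact j' q' ∧ Function.Surjective q' := by
  -- The pushout of `j` and `i` is the quotient of `K' × F` by the antidiagonal copy of `K`.
  let S : Submodule R (K' × F) := LinearMap.range (j.prod (-i))
  have hS : ∀ x : K' × F, x ∈ S ↔ ∃ k, j k = x.1 ∧ -i k = x.2 := fun x => by
    simp [S, LinearMap.mem_range, Prod.ext_iff]
  let p' : ((K' × F) ⧸ S) →ₗ[R] N := S.liftQ (p ∘ₗ LinearMap.snd R K' F) (by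
    rintro _ ⟨k, rfl⟩
    simp [hip.apply_apply_eq_zero])
  let q' : ((K' × F) ⧸ S) →ₗ[R] Q := S.liftQ (q ∘ₗ LinearMap.fst R K' F) (by
    rintro _ ⟨k, rfl⟩
    simp [hjq.apply_apply_eq_zero])
  refine ⟨ModuleCat.of R ((K' × F) ⧸ S), S.mkQ ∘ₗ LinearMap.inl R K' F, p',
    S.mkQ ∘ₗ LinearMap.inr R K' F, q', ?_, ?_, ?_, ?_, ?_, ?_⟩
  · rw [injective_iff_map_eq_zero]
    intro x hx
    obtain ⟨k, hk, hk'⟩ := (hS _).1 ((Submodule.Quotient.mk_eq_zero S).1 hx)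
    have : k = 0 := (injective_iff_map_eq_zero i).1 hi k (by simpa using hk')
    simpa [this] using hk.symm
  · intro y
    obtain ⟨⟨a, b⟩, rfl⟩ := S.mkQ_surjective y
    constructor
    · intro h
      obtain ⟨k, rfl⟩ := (hip b).1 h
      refine ⟨a + j k, ?_⟩
      refine (Submodule.Quotient.eq S).2 ((hS _).2 ⟨k, ?_, ?_⟩) <;> simp
    · rintro ⟨x, hx⟩
      rw [← hx]
      exact map_zero p
  · intro n
    obtain ⟨b, rfl⟩ := hp n
    exact ⟨S.mkQ (0, b), rfl⟩
  · rw [injective_iff_map_eq_zero]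
    intro x hx
    obtain ⟨k, hk, hk'⟩ := (hS _).1 ((Submodule.Quotient.mk_eq_zero S).1 hx)
    have : k = 0 := (injective_iff_map_eq_zero j).1 hj k (by simpa using hk)
    simpa [this] using hk'.symm
  · intro y
    obtain ⟨⟨a, b⟩, rfl⟩ := S.mkQ_surjective y
    constructor
    · intro h
      obtain ⟨k, rfl⟩ := (hjq a).1 h
      refine ⟨b + i k, ?_⟩
      refine (Submodule.Quotient.eq S).2 ((hS _).2 ⟨-k, ?_, ?_⟩) <;> simp
    · rintro ⟨x, hx⟩
      rw [← hx]
      exact map_zero q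
  · intro n
    obtain ⟨b, rfl⟩ := hq n
    exact ⟨S.mkQ (b, 0), rfl⟩

/-- If `F` is embedded in `G` with quotient `Q`, an extension `F` of `N` by `K` induces an
extension `G` of `N'` by `K` and `N` is embedded in `N'` with quotient `Q`. -/
lemma exists_quotient_extension {K F N G Q : Type u} [AddCommGroup K] [Module R K]
    [AddCommGroup F] [Module R F] [AddCommGroup N] [Module R N] [AddCommGroup G] [Module R G]
    [AddCommGroup Q] [Module R Q] {i : K →ₗ[R] F} {p : F →ₗ[R] N} {j : F →ₗ[R] G}
    {q : G →ₗ[R] Q} (hip : Function.Exact i p)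
    (hp : Function.Surjective p) (hj : Function.Injective j) (hjq : Function.Exact j q)
    (hq : Function.Surjective q) :
    ∃ (N' : ModuleCat.{u} R) (p' : G →ₗ[R] N') (j' : N →ₗ[R] N') (q' : N' →ₗ[R] Q),
      Function.Exact (j ∘ₗ i) p' ∧ Function.Surjective p' ∧
      Function.Injective j' ∧ Function.Exact j' q' ∧ Function.Surjective q' := by
  let S : Submodule R G := LinearMap.range (j ∘ₗ i)
  have hker : LinearMap.ker p ≤ LinearMap.ker (S.mkQ ∘ₗ j) := by
    intro b hb
    obtain ⟨k, rfl⟩ := (hip b).1 hb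
    exact (Submodule.Quotient.mk_eq_zero S).2 ⟨k, rfl⟩
  let e := p.quotKerEquivOfSurjective hp
  let j' : N →ₗ[R] (G ⧸ S) := (LinearMap.ker p).liftQ (S.mkQ ∘ₗ j) hker ∘ₗ e.symm.toLinearMap
  have hj' : ∀ b, j' (p b) = S.mkQ (j b) := fun b => by
    have : e.symm (p b) = Submodule.Quotient.mk b := by
      rw [LinearEquiv.symm_apply_eq]; rfl
    simp only [j', LinearMap.comp_apply, LinearEquiv.coe_coe, this]
    rfl
  let q' : (G ⧸ S) →ₗ[R] Q := S.liftQ q (by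
    rintro _ ⟨k, rfl⟩
    exact hjq.apply_apply_eq_zero (i k))
  refine ⟨ModuleCat.of R (G ⧸ S), S.mkQ, j', q', LinearMap.exact_map_mkQ_range _,
    S.mkQ_surjective, ?_, ?_, ?_⟩
  · rw [injective_iff_map_eq_zero]
    intro n hn
    obtain ⟨b, rfl⟩ := hp n
    rw [hj'] at hn
    obtain ⟨k, hk⟩ := (Submodule.Quotient.mk_eq_zero S).1 hn
    rw [← hj hk]
    exact hip.apply_apply_eq_zero k
  · intro y
    obtain ⟨a, rfl⟩ := S.mkQ_surjective y
    constructor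
    · intro h
      obtain ⟨b, rfl⟩ := (hjq a).1 h
      exact ⟨p b, hj' b⟩
    · rintro ⟨x, hx⟩
      obtain ⟨b, rfl⟩ := hp x
      rw [← hx, hj']
      exact hjq.apply_apply_eq_zero b
  · intro n
    obtain ⟨b, rfl⟩ := hq n
    exact ⟨S.mkQ b, rfl⟩

/-- `N` has an exact resolution of length at most `n` by modules in `𝒳`. -/
def HasResolution (𝒳 : ObjectProperty (ModuleCat.{u} R)) : ℕ → ModuleCat.{u} R → Prop
  | 0, N => 𝒳 N
  | n + 1, N => ∃ (K X : ModuleCat.{u} R) (i : K →ₗ[R] X) (p : X →ₗ[R] N), HasResolution 𝒳 n K ∧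
      𝒳 X ∧ Function.Injective i ∧ Function.Exact i p ∧ Function.Surjective p

/-- Flat modules that are cotorsion. -/
def flatCotorsionModules (R : Type u) [CommRing R] : ObjectProperty (ModuleCat.{u} R) :=
  fun N => Module.Flat R N ∧ IsFlatCotorsion R N

lemma HasResolution.mono {𝒳 𝒴 : ObjectProperty (ModuleCat.{u} R)} (h : ∀ X, 𝒳 X → 𝒴 X) {n : ℕ}
    {N : ModuleCat.{u} R} (hN : HasResolution 𝒳 n N) : HasResolution 𝒴 n N := by
  induction n generalizing N with
  | zero => exact h N hN
  | succ n ih =>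
    obtain ⟨K, X, i, p, hK, hX, h'⟩ := hN
    exact ⟨K, X, i, p, ih hK, h X hX, h'⟩

lemma HasResolution.of_equiv {𝒳 : ObjectProperty (ModuleCat.{u} R)}
    (h𝒳 : ∀ X Y : ModuleCat.{u} R, (X ≃ₗ[R] Y) → 𝒳 X → 𝒳 Y) {n : ℕ}
    {N N' : ModuleCat.{u} R} (e : N ≃ₗ[R] N') (hN : HasResolution 𝒳 n N) :
    HasResolution 𝒳 n N' := by
  cases n with
  | zero => exact h𝒳 N N' e hN
  | succ n =>
    obtain ⟨K, X, i, p, hK, hX, hi, hip, hp⟩ := hN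
    refine ⟨K, X, i, e.toLinearMap ∘ₗ p, hK, hX, hi, fun x => ?_, e.surjective.comp hp⟩
    rw [← hip x]
    simp

lemma HasResolution.isFlatCotorsion {n : ℕ} {N : ModuleCat.{u} R}
    (hN : HasResolution (flatCotorsionModules R) n N) : IsFlatCotorsion R N := by
  induction n generalizing N with
  | zero => exact hN.2
  | succ n ih =>
    obtain ⟨K, X, i, p, hK, hX, hi, hip, hp⟩ := hN
    exact fun F _ _ hF => ExtVanish.cokernel hi hip hp (ih hK F hF) (hX.2 F hF)

/-- Recursively enlarge the kernel, push out the extension, and embed the new flat middle term in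
its double character module. Every term becomes flat and cotorsion, while `N` grows only by a flat
cokernel. -/
lemma HasResolution.exists_embedding [IsNoetherianRing R] {n : ℕ} {N : ModuleCat.{u} R}
    (hN : HasResolution (flatModules R) n N) :
    ∃ (N' Q : ModuleCat.{u} R) (j : N →ₗ[R] N') (q : N' →ₗ[R] Q),
      HasResolution (flatCotorsionModules R) n N' ∧ Module.Flat R Q ∧
      Function.Injective j ∧ Function.Exact j q ∧ Function.Surjective q := by
  induction n generalizing N with
  | zero =>
    have hN : Module.Flat R N := hN
    exact ⟨ModuleCat.of R (CharacterModule (CharacterModule N)),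
      ModuleCat.of R (_ ⧸ LinearMap.range (CharacterModule.eval R N)), CharacterModule.eval R N,
      Submodule.mkQ _, ⟨CharacterModule.flat_double, isFlatCotorsion_characterModule _⟩,
      CharacterModule.flat_double_quotient, CharacterModule.eval_injective,
      LinearMap.exact_map_mkQ_range _, Submodule.mkQ_surjective _⟩
  | succ n ih =>
    obtain ⟨K, F, i, p, hK, hF, hi, hip, hp⟩ := hN
    have hF : Module.Flat R F := hF
    obtain ⟨K', Q, j, q, hK', hQ, hj, hjq, hq⟩ := ih hK
    obtain ⟨F', i', p', j', q', hi', hip', hp', hj', hjq', hq'⟩ :=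
      exists_pushout_extension hi hip hp hj hjq hq
    have hF' : Module.Flat R F' := flat_of_flat_extension hjq' hj' hq'
    obtain ⟨N', p'', j'', q'', h1, h2, h3, h4, h5⟩ := exists_quotient_extension hip' hp'
      (CharacterModule.eval_injective (R := R) (A := F')) (LinearMap.exact_map_mkQ_range _)
      (Submodule.mkQ_surjective _)
    exact ⟨N', ModuleCat.of R (_ ⧸ LinearMap.range (CharacterModule.eval R F')), j'', q'',
      ⟨K', ModuleCat.of R (CharacterModule (CharacterModule F')),
        CharacterModule.eval R F' ∘ₗ i', p'', hK',
        ⟨CharacterModule.flat_double, isFlatCotorsion_characterModule _⟩,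
        (CharacterModule.eval_injective (R := R) (A := F')).comp hi', h1, h2⟩,
      CharacterModule.flat_double_quotient, h3, h4, h5⟩

/-- The kernel of the first step of a flat resolution can be chosen cotorsion. -/
lemma HasResolution.exists_cotorsion_kernel [IsNoetherianRing R] {n : ℕ} {N : ModuleCat.{u} R}
    (hN : HasResolution (flatModules R) (n + 1) N) :
    ∃ (K F : ModuleCat.{u} R) (i : K →ₗ[R] F) (p : F →ₗ[R] N),
      HasResolution (flatModules R) n K ∧ IsFlatCotorsion R K ∧ Module.Flat R F ∧
      Function.Injective i ∧ Function.Exact i p ∧ Function.Surjective p := by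
  obtain ⟨K, F, i, p, hK, hF, hi, hip, hp⟩ := hN
  have hF : Module.Flat R F := hF
  obtain ⟨K', Q, j, q, hK', hQ, hj, hjq, hq⟩ := hK.exists_embedding
  obtain ⟨F', i', p', j', q', hi', hip', hp', hj', hjq', hq'⟩ :=
    exists_pushout_extension hi hip hp hj hjq hq
  exact ⟨K', F', i', p', hK'.mono fun _ h => h.1, hK'.isFlatCotorsion,
    flat_of_flat_extension hjq' hj' hq', hi', hip', hp'⟩

end Resolutions

/-! ### Left exactness of Hom. -/

section

variable {R : Type u} [CommRing R] {A B D X : Type u} [AddCommGroup A] [Module R A]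
  [AddCommGroup B] [Module R B] [AddCommGroup D] [Module R D] [AddCommGroup X] [Module R X]

/-- Left exactness of `Hom`. -/
lemma exists_comp_eq_of_exact {f : A →ₗ[R] B} {g : B →ₗ[R] D} (hf : Function.Injective f)
    (h : Function.Exact f g) (φ : X →ₗ[R] B) (hφ : g ∘ₗ φ = 0) :
    ∃ χ : X →ₗ[R] A, f ∘ₗ χ = φ := by
  let φ' : X →ₗ[R] LinearMap.range f := φ.codRestrict _ fun y =>
    (h (φ y)).1 (LinearMap.congr_fun hφ y)
  refine ⟨(LinearEquiv.ofInjective f hf).symm.toLinearMap ∘ₗ φ', LinearMap.ext fun y => ?_⟩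
  exact congrArg Subtype.val ((LinearEquiv.ofInjective f hf).apply_symm_apply (φ' y))

end

/-! ### Splicing, truncating and transporting augmented complexes. -/

namespace AugmentedComplex

variable {R : Type u} [CommRing R] {M N K : Type u} [AddCommGroup M] [Module R M]
  [AddCommGroup N] [Module R N] [AddCommGroup K] [Module R K]

lemma length_le_iff (A : AugmentedComplex R M) (n : ℕ) :
    A.length ≤ (n : WithBot ℕ∞) ↔ ∀ i, n < i → Subsingleton (A.X i) := by
  have hcast : ∀ i : ℕ, (i : WithBot ℕ∞) ≤ (n : WithBot ℕ∞) ↔ i ≤ n := fun i => by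
    exact_mod_cast Iff.rfl
  simp only [length, iSup_le_iff, hcast]
  refine forall_congr' fun i => ?_
  rw [← not_nontrivial_iff_subsingleton, ← not_lt]
  tauto

lemma length_le_of_nontrivial (A : AugmentedComplex R M) (B : AugmentedComplex R N)
    (h : ∀ i, Nontrivial (A.X i) → Nontrivial (B.X i)) : A.length ≤ B.length :=
  iSup_mono fun i => iSup_mono' fun hi => ⟨h i hi, le_rfl⟩

/-- Exactness is exactness after applying `Hom(R, -)`. -/
lemma isExact_iff_isHomExact (A : AugmentedComplex R M) :
    A.IsExact ↔ A.IsHomExact (ModuleCat.of R R) := by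
  have hex : ∀ {X Y Z : Type u} [AddCommGroup X] [Module R X] [AddCommGroup Y] [Module R Y]
      [AddCommGroup Z] [Module R Z] (f : X →ₗ[R] Y) (g : Y →ₗ[R] Z),
      Function.Exact f g ↔
        Function.Exact (fun h : R →ₗ[R] X => f ∘ₗ h) (fun h : R →ₗ[R] Y => g ∘ₗ h) := by
    intro X Y Z _ _ _ _ _ _ f g
    constructor
    · intro h φ
      constructor
      · intro hφ
        obtain ⟨x, hx⟩ := (h (φ 1)).1 (LinearMap.congr_fun hφ 1)
        exact ⟨LinearMap.toSpanSingleton R X x, LinearMap.ext_ring (by simpa using hx)⟩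
      · rintro ⟨ψ, rfl⟩
        exact LinearMap.ext_ring (h.apply_apply_eq_zero (ψ 1))
    · intro h y
      constructor
      · intro hy
        obtain ⟨ψ, hψ⟩ := (h (LinearMap.toSpanSingleton R Y y)).1
          (LinearMap.ext_ring (by simpa using hy))
        exact ⟨ψ 1, by simpa using LinearMap.congr_fun hψ 1⟩
      · rintro ⟨x, rfl⟩
        have := (h _).2 ⟨LinearMap.toSpanSingleton R X x, rfl⟩
        simpa using LinearMap.congr_fun this 1
  constructor
  · intro h
    refine ⟨fun φ => ?_, (hex _ _).1 h.exact_zero, fun i => (hex _ _).1 (h.exact_succ i)⟩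
    obtain ⟨x, hx⟩ := h.surjective_aug (φ (1 : R))
    exact ⟨LinearMap.toSpanSingleton R _ x, LinearMap.ext_ring (by simpa using hx)⟩
  · intro h
    refine ⟨fun m => ?_, (hex _ _).2 h.exact_zero, fun i => (hex _ _).2 (h.exact_succ i)⟩
    obtain ⟨φ, hφ⟩ := h.surjective_aug (LinearMap.toSpanSingleton R _ m)
    exact ⟨φ (1 : R), by simpa using LinearMap.congr_fun hφ (1 : R)⟩

/-- Transfer of exactness along compatible bijections of `Hom`-groups. -/
lemma IsHomExact.of_equiv {A : AugmentedComplex R M} {B : AugmentedComplex R N}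
    {Y Z : ModuleCat.{u} R} (hA : A.IsHomExact Y)
    (e : ∀ i, (Y →ₗ[R] A.X i) ≃+ (Z →ₗ[R] B.X i)) (e' : (Y →ₗ[R] M) ≃+ (Z →ₗ[R] N))
    (hd : ∀ i f, e i (A.d i ∘ₗ f) = B.d i ∘ₗ e (i + 1) f)
    (haug : ∀ f, e' (A.aug ∘ₗ f) = B.aug ∘ₗ e 0 f) : B.IsHomExact Z := by
  refine ⟨fun φ => ?_, fun φ => ?_, fun i φ => ?_⟩
  · obtain ⟨ψ, hψ⟩ := hA.surjective_aug (e'.symm φ)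
    refine ⟨e 0 ψ, ?_⟩
    dsimp only at hψ ⊢
    rw [← haug, hψ, AddEquiv.apply_symm_apply]
  · obtain ⟨φ, rfl⟩ := (e 0).surjective φ
    dsimp only
    rw [← haug, EmbeddingLike.map_eq_zero_iff]
    refine (hA.exact_zero φ).trans ⟨?_, ?_⟩
    · rintro ⟨ψ, rfl⟩
      exact ⟨e 1 ψ, (hd 0 ψ).symm⟩
    · rintro ⟨ψ, hψ⟩
      obtain ⟨ψ, rfl⟩ := (e 1).surjective ψ
      exact ⟨ψ, (e 0).injective ((hd 0 ψ).trans hψ)⟩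
  · obtain ⟨φ, rfl⟩ := (e (i + 1)).surjective φ
    dsimp only
    rw [← hd, EmbeddingLike.map_eq_zero_iff]
    refine (hA.exact_succ i φ).trans ⟨?_, ?_⟩
    · rintro ⟨ψ, rfl⟩
      exact ⟨e (i + 2) ψ, (hd (i + 1) ψ).symm⟩
    · rintro ⟨ψ, hψ⟩
      obtain ⟨ψ, rfl⟩ := (e (i + 2)).surjective ψ
      exact ⟨ψ, (e (i + 1)).injective ((hd (i + 1) ψ).trans hψ)⟩

/-- The complex `⋯ → 0 → X → X → 0`. -/
def single (X : ModuleCat.{u} R) : AugmentedComplex R X where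
  X i := Nat.casesOn i X fun _ => ModuleCat.of R PUnit
  d _ := 0
  aug := LinearMap.id
  d_comp_d _ := rfl
  aug_comp_d := rfl

lemma isHomExact_single (X Y : ModuleCat.{u} R) : (single X).IsHomExact Y := by
  refine ⟨fun φ => ⟨φ, rfl⟩, fun φ => ⟨fun h => ⟨0, ?_⟩, ?_⟩, fun i φ => ⟨fun _ => ⟨0, ?_⟩, ?_⟩⟩
  · exact h.symm
  · rintro ⟨ψ, rfl⟩
    rfl
  · rfl
  · intro _
    rfl

/-- Splicing a complex augmented to `K` with `K → X → N`. -/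
def cons (A : AugmentedComplex R K) (X : ModuleCat.{u} R) (i : K →ₗ[R] X) (p : X →ₗ[R] N)
    (h : p ∘ₗ i = 0) : AugmentedComplex R N where
  X n := Nat.casesOn n X A.X
  d n := match n with
    | 0 => i ∘ₗ A.aug
    | n + 1 => A.d n
  aug := p
  d_comp_d n := by
    cases n with
    | zero =>
      change (i ∘ₗ A.aug) ∘ₗ A.d 0 = 0
      rw [LinearMap.comp_assoc, A.aug_comp_d, LinearMap.comp_zero]
    | succ n => exact A.d_comp_d n
  aug_comp_d := by
    change p ∘ₗ (i ∘ₗ A.aug) = 0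
    rw [← LinearMap.comp_assoc, h, LinearMap.zero_comp]

/-- Left exactness of `Hom(Y, -)` covers everything at the splice except surjectivity onto `Hom(Y,
N)`, which is why lifting along `p` is assumed. -/
lemma IsHomExact.cons {A : AugmentedComplex R K} {Y : ModuleCat.{u} R} (hA : A.IsHomExact Y)
    {X : ModuleCat.{u} R} {i : K →ₗ[R] X} {p : X →ₗ[R] N} (hi : Function.Injective i)
    (hip : Function.Exact i p) (hp : ∀ φ : Y →ₗ[R] N, ∃ ψ : Y →ₗ[R] X, p ∘ₗ ψ = φ) :
    (A.cons X i p hip.linearMap_comp_eq_zero).IsHomExact Y := by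
  refine ⟨hp, fun φ => ?_, fun n => ?_⟩
  · change p ∘ₗ φ = 0 ↔ ∃ ψ : Y →ₗ[R] A.X 0, (i ∘ₗ A.aug) ∘ₗ ψ = φ
    constructor
    · intro h
      obtain ⟨χ, rfl⟩ := exists_comp_eq_of_exact hi hip φ h
      obtain ⟨ψ, rfl⟩ := hA.surjective_aug χ
      exact ⟨ψ, LinearMap.comp_assoc _ _ _⟩
    · rintro ⟨ψ, rfl⟩
      rw [LinearMap.comp_assoc, ← LinearMap.comp_assoc, hip.linearMap_comp_eq_zero,
        LinearMap.zero_comp]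
  · cases n with
    | zero =>
      intro (φ : Y →ₗ[R] A.X 0)
      refine Iff.trans ?_ (hA.exact_zero φ)
      change (i ∘ₗ A.aug) ∘ₗ φ = 0 ↔ A.aug ∘ₗ φ = 0
      rw [LinearMap.comp_assoc]
      constructor
      · intro h
        ext y
        exact hi ((LinearMap.congr_fun h y).trans (map_zero i).symm)
      · intro h
        rw [h, LinearMap.comp_zero]
    | succ n => exact hA.exact_succ n

/-- The complex augmented to the kernel of the augmentation. -/
def tail (A : AugmentedComplex R M) : AugmentedComplex R (LinearMap.ker A.aug) where
  X n := A.X (n + 1)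
  d n := A.d (n + 1)
  aug := (A.d 0).codRestrict _ fun x => LinearMap.congr_fun A.aug_comp_d x
  d_comp_d n := A.d_comp_d (n + 1)
  aug_comp_d := LinearMap.ext fun x => Subtype.ext (LinearMap.congr_fun (A.d_comp_d 0) x)

lemma IsExact.tail {A : AugmentedComplex R M} (hA : A.IsExact) : A.tail.IsExact := by
  refine ⟨?_, fun y => ?_, fun i => hA.exact_succ (i + 1)⟩
  · rintro ⟨x, hx⟩
    obtain ⟨y, hy⟩ := (hA.exact_zero x).1 hx
    exact ⟨y, Subtype.ext hy⟩
  · refine Iff.trans ?_ (hA.exact_succ 0 y)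
    exact Subtype.ext_iff

/-- A bounded exact complex gives a finite resolution. -/
lemma IsExact.hasResolution {𝒳 : ObjectProperty (ModuleCat.{u} R)}
    (h𝒳 : ∀ X Y : ModuleCat.{u} R, (X ≃ₗ[R] Y) → 𝒳 X → 𝒳 Y) {n : ℕ} {A : AugmentedComplex R M}
    (hA : A.IsExact) (hmem : ∀ i, i ≤ n → 𝒳 (A.X i)) (hsub : ∀ i, n < i → Subsingleton (A.X i)) :
    HasResolution 𝒳 n (ModuleCat.of R M) := by
  induction n generalizing M with
  | zero =>
    refine h𝒳 (A.X 0) _ (LinearEquiv.ofBijective A.aug ⟨?_, hA.surjective_aug⟩) (hmem 0 le_rfl)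
    rw [injective_iff_map_eq_zero]
    intro x hx
    obtain ⟨y, rfl⟩ := (hA.exact_zero x).1 hx
    have := hsub 1 zero_lt_one
    rw [Subsingleton.elim y 0, map_zero]
  | succ n ih =>
    exact ⟨ModuleCat.of R (LinearMap.ker A.aug), A.X 0, Submodule.subtype _, A.aug,
      ih hA.tail (fun i hi => hmem (i + 1) (by lia)) (fun i hi => hsub (i + 1) (by lia)),
      hmem 0 (Nat.zero_le _), Submodule.injective_subtype _, LinearMap.exact_subtype_ker_map _,
      hA.surjective_aug⟩

end AugmentedComplex

/-! ### Relative dimension in terms of bounded resolutions. -/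

section

variable {R : Type u} [CommRing R]

open AugmentedComplex

/-- A finite resolution gives a bounded exact complex. -/
lemma HasResolution.exists_isExact {𝒳 : ObjectProperty (ModuleCat.{u} R)} {n : ℕ}
    {N : ModuleCat.{u} R} (hN : HasResolution 𝒳 n N) :
    ∃ A : AugmentedComplex R N, A.IsExact ∧ (∀ i, i ≤ n → 𝒳 (A.X i)) ∧
      ∀ i, n < i → Subsingleton (A.X i) := by
  simp only [isExact_iff_isHomExact]
  induction n generalizing N with
  | zero =>
    refine ⟨single N, isHomExact_single _ _, fun i hi => ?_, fun i hi => ?_⟩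
    · obtain rfl : i = 0 := by lia
      exact hN
    · obtain ⟨i, rfl⟩ := Nat.exists_eq_succ_of_ne_zero hi.ne'
      exact inferInstanceAs (Subsingleton PUnit)
  | succ n ih =>
    obtain ⟨K, X, i, p, hK, hX, hi, hip, hp⟩ := hN
    obtain ⟨A, hA, hmem, hsub⟩ := ih hK
    refine ⟨A.cons X i p hip.linearMap_comp_eq_zero, hA.cons hi hip fun φ => ?_,
      fun j hj => ?_, fun j hj => ?_⟩
    · obtain ⟨x, hx⟩ := hp (φ (1 : R))
      exact ⟨LinearMap.toSpanSingleton R _ x, LinearMap.ext_ring (by simpa using hx)⟩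
    · cases j with
      | zero => exact hX
      | succ j => exact hmem j (by lia)
    · cases j with
      | zero => lia
      | succ j => exact hsub j (by lia)

/-- Over a noetherian ring, a module with a finite flat resolution has a proper flat resolution of
the same length. -/
lemma HasResolution.exists_isProperResolution [IsNoetherianRing R] {n : ℕ}
    {N : ModuleCat.{u} R} (hN : HasResolution (flatModules R) n N) :
    ∃ A : AugmentedComplex R N, A.IsProperResolution (flatModules R) ∧
      ∀ i, n < i → Subsingleton (A.X i) := by
  induction n generalizing N with
  | zero =>
    refine ⟨single N, ⟨fun i => ?_, fun Y _ => isHomExact_single _ _⟩, fun i hi => ?_⟩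
    · cases i with
      | zero => exact hN
      | succ i => exact inferInstanceAs (Module.Flat R PUnit.{u + 1})
    · obtain ⟨i, rfl⟩ := Nat.exists_eq_succ_of_ne_zero hi.ne'
      exact inferInstanceAs (Subsingleton PUnit)
  | succ n ih =>
    obtain ⟨K, X, i, p, hK, hcot, hX, hi, hip, hp⟩ := hN.exists_cotorsion_kernel
    obtain ⟨A, hA, hsub⟩ := ih hK
    refine ⟨A.cons X i p hip.linearMap_comp_eq_zero,
      ⟨fun j => ?_, fun Y hY => (hA.isHomExact Y hY).cons hi hip
        (exists_lift_of_subsingleton_ext hi hip hp (hcot Y hY 0))⟩, fun j hj => ?_⟩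
    · cases j with
      | zero => exact hX
      | succ j => exact hA.mem j
    · cases j with
      | zero => lia
      | succ j => exact hsub j (by lia)

lemma relProjDim_le_iff (𝒳 : ObjectProperty (ModuleCat.{u} R)) (M : Type u) [AddCommGroup M]
    [Module R M] (n : ℕ) : relProjDim 𝒳 M ≤ (n : WithBot ℕ∞) ↔
      ∃ A : AugmentedComplex R M, A.IsProperResolution 𝒳 ∧
        ∀ i, n < i → Subsingleton (A.X i) := by
  constructor
  · intro h
    -- A strict bound by `n + 1` is what extracts an actual resolution from the infimum.
    have hlt : relProjDim 𝒳 M < ((n + 1 : ℕ) : WithBot ℕ∞) :=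
      h.trans_lt (by exact_mod_cast Nat.lt_succ_self n)
    simp only [relProjDim, iInf_lt_iff] at hlt
    obtain ⟨A, hA, hlen⟩ := hlt
    refine ⟨A, hA, fun i hi => ?_⟩
    by_contra hne
    rw [not_subsingleton_iff_nontrivial] at hne
    have hle : (i : WithBot ℕ∞) < ((n + 1 : ℕ) : WithBot ℕ∞) :=
      (le_iSup₂ (f := fun (n : ℕ) (_ : Nontrivial (A.X n)) => (n : WithBot ℕ∞)) i hne).trans_lt
        hlen
    have : i < n + 1 := by exact_mod_cast hle
    lia
  · rintro ⟨A, hA, hsub⟩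
    exact iInf₂_le_of_le A hA ((A.length_le_iff n).2 hsub)

lemma relProjDim_le_of_equiv (𝒳 : ObjectProperty (ModuleCat.{u} R)) {M N : Type u}
    [AddCommGroup M] [Module R M] [AddCommGroup N] [Module R N] (e : M ≃ₗ[R] N) :
    relProjDim 𝒳 N ≤ relProjDim 𝒳 M := by
  refine le_iInf₂ fun A hA => ?_
  let B : AugmentedComplex R N :=
    { A with
      aug := e.toLinearMap ∘ₗ A.aug
      aug_comp_d := by rw [LinearMap.comp_assoc, A.aug_comp_d, LinearMap.comp_zero] }
  refine iInf₂_le_of_le B ⟨hA.mem, fun Y hY => ?_⟩ le_rfl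
  exact (hA.isHomExact Y hY).of_equiv (B := B) (fun _ => AddEquiv.refl _)
    (LinearEquiv.congrRight e).toAddEquiv (fun _ _ => rfl) (fun _ => rfl)

lemma relProjDim_congr (𝒳 : ObjectProperty (ModuleCat.{u} R)) {M N : Type u}
    [AddCommGroup M] [Module R M] [AddCommGroup N] [Module R N] (e : M ≃ₗ[R] N) :
    relProjDim 𝒳 M = relProjDim 𝒳 N :=
  le_antisymm (relProjDim_le_of_equiv 𝒳 e.symm) (relProjDim_le_of_equiv 𝒳 e)

lemma flatModules_of_equiv (X Y : ModuleCat.{u} R) (e : X ≃ₗ[R] Y) (h : flatModules R X) :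
    flatModules R Y := by
  have : Module.Flat R X := h
  exact Module.Flat.of_linearEquiv e.symm

/-- Finite flat dimension is detected by exact resolutions. -/
lemma flatDim_le_iff_hasResolution [IsNoetherianRing R] (N : Type u) [AddCommGroup N] [Module R N]
    (n : ℕ) : flatDim R N ≤ (n : WithBot ℕ∞) ↔
      HasResolution (flatModules R) n (ModuleCat.of R N) := by
  refine (relProjDim_le_iff _ _ _).trans
    ⟨?_, fun h => HasResolution.exists_isProperResolution h⟩
  rintro ⟨A, hA, hsub⟩
  exact IsExact.hasResolution flatModules_of_equiv (A.isExact_iff_isHomExact.2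
    (hA.isHomExact _ (inferInstance : Module.Flat R R))) (fun i _ => hA.mem i) hsub

end

/-! ### Tensor evaluation for flat modules. -/

section HomTensor

variable {R : Type u} [CommRing R]
variable {A B D F X : Type u} [AddCommGroup A] [Module R A] [AddCommGroup B] [Module R B]
  [AddCommGroup D] [Module R D] [AddCommGroup F] [Module R F] [AddCommGroup X] [Module R X]

/-- Right exactness of `Hom` in the first variable. -/
lemma exact_lcomp (X : Type u) [AddCommGroup X] [Module R X] {f : A →ₗ[R] B} {g : B →ₗ[R] D}
    (h : Function.Exact f g) (hg : Function.Surjective g) :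
    Function.Exact (LinearMap.lcomp R X g) (LinearMap.lcomp R X f) := by
  intro φ
  constructor
  · intro hφ
    have hker : LinearMap.ker g ≤ LinearMap.ker φ := by
      intro b hb
      obtain ⟨a, rfl⟩ := (h b).1 hb
      exact LinearMap.congr_fun hφ a
    refine ⟨(LinearMap.ker g).liftQ φ hker ∘ₗ (g.quotKerEquivOfSurjective hg).symm.toLinearMap,
      LinearMap.ext fun b => ?_⟩
    have : (g.quotKerEquivOfSurjective hg).symm (g b) = Submodule.Quotient.mk b := by
      rw [LinearEquiv.symm_apply_eq]; rfl
    simp [this]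
  · rintro ⟨ψ, rfl⟩
    ext a
    simp [h.apply_apply_eq_zero]

lemma lTensorHomToHomLTensor_comp (f : A →ₗ[R] B) (x : F ⊗[R] (B →ₗ[R] X)) :
    TensorProduct.lTensorHomToHomLTensor (.id R) B F X x ∘ₗ f =
      TensorProduct.lTensorHomToHomLTensor (.id R) A F X
        ((LinearMap.lcomp R X f).lTensor F x) := by
  induction x with
  | zero => simp
  | add x y hx hy => rw [map_add, LinearMap.add_comp, hx, hy, map_add, map_add]
  | tmul a φ => ext; simp

lemma lTensorHomToHomLTensor_injective [Module.Finite R A] [Module.Flat R F] :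
    Function.Injective (TensorProduct.lTensorHomToHomLTensor (.id R) A F X) := by
  obtain ⟨n, p, hp⟩ := Module.Finite.exists_fin' R A
  rw [injective_iff_map_eq_zero]
  intro x hx
  -- Naturality along `R^n → A` reduces to the free module, where tensor evaluation is an
  -- isomorphism.
  have h1 := lTensorHomToHomLTensor_comp p x
  rw [hx, LinearMap.zero_comp, ← lTensorHomEquivHomLTensor_apply, eq_comm,
    EmbeddingLike.map_eq_zero_iff] at h1
  refine (injective_iff_map_eq_zero _).1
    (Module.Flat.lTensor_preserves_injective_linearMap (M := F) _ ?_) x h1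
  intro φ ψ h
  ext a
  obtain ⟨y, rfl⟩ := hp a
  exact LinearMap.congr_fun h y

/-- Tensor evaluation `F ⊗ Hom(A, X) → Hom(A, F ⊗ X)` is bijective for finite `A` and flat `F`. -/
lemma lTensorHomToHomLTensor_bijective [IsNoetherianRing R] [Module.Finite R A]
    [Module.Flat R F] :
    Function.Bijective (TensorProduct.lTensorHomToHomLTensor (.id R) A F X) := by
  refine ⟨lTensorHomToHomLTensor_injective, fun φ => ?_⟩
  obtain ⟨n, p, hp⟩ := Module.Finite.exists_fin' R A
  obtain ⟨x, hx⟩ := (lTensorHomEquivHomLTensor R (Fin n → R) F X).surjective (φ ∘ₗ p)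
  rw [lTensorHomEquivHomLTensor_apply] at hx
  have hex := p.exact_subtype_ker_map
  -- The preimage `x` of `φ ∘ p` dies on the kernel of `p`, by injectivity of tensor evaluation
  -- there; this is where the kernel must be finite.
  have h1 : (LinearMap.lcomp R X (LinearMap.ker p).subtype).lTensor F x = 0 := by
    refine lTensorHomToHomLTensor_injective ?_
    rw [← lTensorHomToHomLTensor_comp, hx, map_zero, LinearMap.comp_assoc,
      hex.linearMap_comp_eq_zero, LinearMap.comp_zero]
  obtain ⟨y, rfl⟩ := (Module.Flat.lTensor_exact F (exact_lcomp X hex hp) x).1 h1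
  refine ⟨y, LinearMap.ext fun a => ?_⟩
  obtain ⟨b, rfl⟩ := hp a
  rw [← lTensorHomToHomLTensor_comp] at hx
  exact LinearMap.congr_fun hx b

/-- Vanishing of `Ext` out of a finite module is preserved by tensoring with a flat module. -/
lemma ExtVanish.flat_tensor [IsNoetherianRing R] (F : Type u) [AddCommGroup F] [Module R F]
    [Module.Flat R F] {A X : Type u} [AddCommGroup A] [Module R A] [AddCommGroup X] [Module R X]
    [Module.Finite R A] (h : ExtVanish R A X) : ExtVanish R A (F ⊗[R] X) := by
  intro i
  induction i generalizing A with
  | zero =>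
    obtain ⟨n, p, hp⟩ := Module.Finite.exists_fin' R A
    refine subsingleton_ext_one_of_extension (Submodule.injective_subtype _)
      p.exact_subtype_ker_map hp fun φ => ?_
    obtain ⟨x, rfl⟩ := lTensorHomToHomLTensor_bijective.2 φ
    have hsurj : Function.Surjective (LinearMap.lcomp R X (LinearMap.ker p).subtype) :=
      exists_extension_of_subsingleton_ext (Submodule.injective_subtype _)
        p.exact_subtype_ker_map hp (h 0)
    obtain ⟨y, rfl⟩ := LinearMap.lTensor_surjective F hsurj x
    exact ⟨_, lTensorHomToHomLTensor_comp _ y⟩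
  | succ i ih =>
    obtain ⟨n, p, hp⟩ := Module.Finite.exists_fin' R A
    refine subsingleton_ext_of_syzygy (Submodule.injective_subtype _)
      p.exact_subtype_ker_map hp (ih fun j => ?_)
    exact subsingleton_ext_syzygy (Submodule.injective_subtype _)
      p.exact_subtype_ker_map hp (h (j + 1))

/-- If tensoring with `C` preserves one flat presentation of `N`, it preserves injectivity of all
kernels of surjections to `N`. -/
lemma rTensor_injective_of_flat_presentation {C K F N : Type u} [AddCommGroup C] [Module R C]
    [AddCommGroup K] [Module R K] [AddCommGroup F] [Module R F] [AddCommGroup N] [Module R N]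
    [Module.Flat R F] {i : K →ₗ[R] F} {p : F →ₗ[R] N}
    (hip : Function.Exact i p) (hp : Function.Surjective p)
    (hC : Function.Injective (i.rTensor C)) {f : A →ₗ[R] B} {g : B →ₗ[R] N}
    (hf : Function.Injective f) (hfg : Function.Exact f g) (hg : Function.Surjective g) :
    Function.Injective (f.rTensor C) := by
  -- `S` is the fibre product of `B` and `F` over `N`. It contains `A` with cokernel `F` and `K`
  -- with cokernel `B`, which allows the two presentations to be compared.
  let S : Submodule R (B × F) :=
    LinearMap.ker (g ∘ₗ LinearMap.fst R B F - p ∘ₗ LinearMap.snd R B F)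
  have hS : ∀ x : S, g x.1.1 = p x.1.2 := fun x => by
    exact sub_eq_zero.1 (LinearMap.mem_ker.1 x.2)
  let πB : S →ₗ[R] B := LinearMap.fst R B F ∘ₗ S.subtype
  let πF : S →ₗ[R] F := LinearMap.snd R B F ∘ₗ S.subtype
  let ιA : A →ₗ[R] S := (LinearMap.inl R B F ∘ₗ f).codRestrict S fun a => by
    simp [S, hfg.apply_apply_eq_zero]
  let ιK : K →ₗ[R] S := (LinearMap.inr R B F ∘ₗ i).codRestrict S fun a => by
    simp [S, hip.apply_apply_eq_zero]
  have hιA : Function.Injective ιA := fun _ _ h =>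
    hf (congrArg (fun x : S => x.1.1) h)
  have hA : Function.Exact ιA πF := by
    intro x
    constructor
    · intro hx
      have hx' : x.1.2 = 0 := hx
      obtain ⟨a, ha⟩ := (hfg x.1.1).1 (by rw [hS, hx', map_zero])
      exact ⟨a, Subtype.ext (Prod.ext ha hx'.symm)⟩
    · rintro ⟨a, rfl⟩
      rfl
  have hK : Function.Exact ιK πB := by
    intro x
    constructor
    · intro hx
      have hx' : x.1.1 = 0 := hx
      obtain ⟨a, ha⟩ := (hip x.1.2).1 (by rw [← hS, hx', map_zero])
      exact ⟨a, Subtype.ext (Prod.ext hx'.symm ha)⟩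
    · rintro ⟨a, rfl⟩
      rfl
  have hπF : Function.Surjective πF := fun b => by
    obtain ⟨a, ha⟩ := hg (p b)
    exact ⟨⟨(a, b), by simp [S, ha]⟩, rfl⟩
  have hπB : Function.Surjective πB := fun b => by
    obtain ⟨a, ha⟩ := hp (g b)
    exact ⟨⟨(b, a), by simp [S, ha]⟩, rfl⟩
  have hAinj : Function.Injective (ιA.rTensor C) := rTensor_injective_of_flat_cokernel C hιA hA hπF
  have hfc : f = πB ∘ₗ ιA := rfl
  have hic : i = πF ∘ₗ ιK := rfl
  rw [injective_iff_map_eq_zero]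
  intro x hx
  rw [hfc, LinearMap.rTensor_comp, LinearMap.comp_apply] at hx
  obtain ⟨y, hy⟩ := (rTensor_exact C hK hπB _).1 hx
  have h0 : i.rTensor C y = 0 := by
    rw [hic, LinearMap.rTensor_comp, LinearMap.comp_apply, hy, ← LinearMap.comp_apply,
      ← LinearMap.rTensor_comp, hA.linearMap_comp_eq_zero, LinearMap.rTensor_zero,
      LinearMap.zero_apply]
  rw [(injective_iff_map_eq_zero _).1 hC y h0, map_zero] at hy
  exact (injective_iff_map_eq_zero _).1 hAinj x hy.symm

end HomTensor

/-! ### Faithfulness of `C` and the Foxby equivalence. -/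

section Semidualizing

variable {R : Type u} [CommRing R] {C : Type u} [AddCommGroup C] [Module R C]

lemma IsSemidualizing.extVanish (hC : IsSemidualizing R C) : ExtVanish R C C :=
  fun i => hC.subsingleton_ext (i + 1) (by lia)

lemma IsSemidualizing.annihilator_eq_bot (hC : IsSemidualizing R C) :
    Module.annihilator R C = ⊥ := by
  rw [eq_bot_iff]
  intro r hr
  rw [Module.mem_annihilator] at hr
  exact hC.bijective_homothety.1 (LinearMap.ext fun c => by simpa using hr c)

/-- The evaluation map `Hom(C, M) ⊗ C → M`. -/
noncomputable def homTensorEval (R : Type u) [CommRing R] (C : Type u) [AddCommGroup C]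
    [Module R C] (M : Type u) [AddCommGroup M] [Module R M] : (C →ₗ[R] M) ⊗[R] C →ₗ[R] M :=
  TensorProduct.lift LinearMap.id

lemma homTensorEval_tmul (M : Type u) [AddCommGroup M] [Module R M] (φ : C →ₗ[R] M) (c : C) :
    homTensorEval R C M (φ ⊗ₜ c) = φ c := by
  simp [homTensorEval]

lemma cFlatModules_of_equiv (X Y : ModuleCat.{u} R) (e : X ≃ₗ[R] Y) (h : cFlatModules R C X) :
    cFlatModules R C Y := by
  obtain ⟨F, hF, ⟨e'⟩⟩ := h
  exact ⟨F, hF, ⟨e.symm ≪≫ₗ e'⟩⟩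

variable [IsNoetherianRing R]

/-- On a cyclic submodule `R z`, vanishing of Hom from the finite module `C` yields an annihilator
of `C` that is regular on `R z`. As `C` is faithful this element is zero, so `z = 0`. -/
lemma IsSemidualizing.subsingleton_of_hom (hC : IsSemidualizing R C) (Z : Type u)
    [AddCommGroup Z] [Module R Z] (h : ∀ φ : C →ₗ[R] Z, φ = 0) : Subsingleton Z := by
  have := hC.finite
  refine subsingleton_of_forall_eq 0 fun z => ?_
  have hsub : Subsingleton (C →ₗ[R] (R ∙ z)) := subsingleton_of_forall_eq 0 fun φ =>
    LinearMap.ext fun c => Subtype.ext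
      (LinearMap.congr_fun (h ((R ∙ z).subtype ∘ₗ φ)) c)
  obtain ⟨r, hr, hreg⟩ := IsSMulRegular.subsingleton_linearMap_iff.1 hsub
  rw [hC.annihilator_eq_bot, Submodule.mem_bot] at hr
  have hz : (⟨z, Submodule.mem_span_singleton_self z⟩ : R ∙ z) = 0 :=
    hreg (by simp [hr])
  exact congrArg Subtype.val hz

lemma IsSemidualizing.injective_of_hom (hC : IsSemidualizing R C) {X Y : Type u} [AddCommGroup X]
    [Module R X] [AddCommGroup Y] [Module R Y] (g : X →ₗ[R] Y)
    (h : ∀ φ : C →ₗ[R] X, g ∘ₗ φ = 0 → φ = 0) : Function.Injective g := by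
  have := hC.subsingleton_of_hom (LinearMap.ker g) fun φ => by
    have h0 := h ((LinearMap.ker g).subtype ∘ₗ φ) (by
      rw [← LinearMap.comp_assoc, g.exact_subtype_ker_map.linearMap_comp_eq_zero,
        LinearMap.zero_comp])
    exact LinearMap.ext fun c => Subtype.ext (LinearMap.congr_fun h0 c)
  exact LinearMap.ker_eq_bot.1 (Submodule.eq_bot_of_subsingleton)

/-- Maps from `C` to the character module of `K` are characters of `C ⊗ K`, so this is dual to
`IsSemidualizing.subsingleton_of_hom`. -/
lemma IsSemidualizing.subsingleton_of_tensor (hC : IsSemidualizing R C) (K : Type u)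
    [AddCommGroup K] [Module R K] (h : Subsingleton (K ⊗[R] C)) : Subsingleton K := by
  have := hC.subsingleton_of_hom (CharacterModule K) fun φ => by
    refine CharacterModule.homEquiv.injective (CharacterModule.ext _ fun x => ?_)
    have hs : Subsingleton (C ⊗[R] K) := (TensorProduct.comm R C K).toEquiv.subsingleton
    rw [Subsingleton.elim x 0, map_zero, map_zero]
  refine subsingleton_of_forall_eq 0 fun k => CharacterModule.eq_zero_of_character_apply fun c => ?_
  rw [Subsingleton.elim c 0]
  rfl

lemma IsSemidualizing.unit_bijective (hC : IsSemidualizing R C) (F : Type u) [AddCommGroup F]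
    [Module R F] [Module.Flat R F] : Function.Bijective (TensorProduct.mk R F C) := by
  have := hC.finite
  let e := (TensorProduct.rid R F).symm ≪≫ₗ
    (LinearEquiv.ofBijective (LinearMap.lsmul R C) hC.bijective_homothety).lTensor F ≪≫ₗ
    LinearEquiv.ofBijective (TensorProduct.lTensorHomToHomLTensor (.id R) C F C)
      lTensorHomToHomLTensor_bijective
  have he : TensorProduct.mk R F C = e.toLinearMap := by
    ext x c
    simp [e]
  rw [he]
  exact e.bijective

/-- A module of finite flat dimension lies in the Auslander class of `C`. -/
lemma HasResolution.auslander (hC : IsSemidualizing R C) {n : ℕ} {N : ModuleCat.{u} R}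
    (hN : HasResolution (flatModules R) n N) :
    Function.Bijective (TensorProduct.mk R N C) ∧ ExtVanish R C (N ⊗[R] C) ∧
    HasResolution (cFlatModules R C) n (ModuleCat.of R (N ⊗[R] C)) ∧
    ∀ (A B : Type u) [AddCommGroup A] [Module R A] [AddCommGroup B] [Module R B]
      (f : A →ₗ[R] B) (g : B →ₗ[R] N), Function.Injective f → Function.Exact f g →
      Function.Surjective g → Function.Injective (f.rTensor C) := by
  have := hC.finite
  induction n generalizing N with
  | zero =>
    have hN : Module.Flat R N := hN
    exact ⟨hC.unit_bijective N, hC.extVanish.flat_tensor N,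
      ⟨N, hN, ⟨LinearEquiv.refl R _⟩⟩,
      fun A B _ _ _ _ f g hf hfg hg => rTensor_injective_of_flat_cokernel C hf hfg hg⟩
  | succ n ih =>
    obtain ⟨K, F, i, p, hK, hF, hi, hip, hp⟩ := hN
    have hF : Module.Flat R F := hF
    obtain ⟨hKu, hKe, hKr, -⟩ := ih hK
    have hFu := hC.unit_bijective F
    have hmk : ∀ {X Y : Type u} [AddCommGroup X] [Module R X] [AddCommGroup Y] [Module R Y]
        (f : X →ₗ[R] Y) (x : X), f.rTensor C ∘ₗ TensorProduct.mk R X C x =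
          TensorProduct.mk R Y C (f x) := fun f x => rfl
    -- Injectivity can be tested on maps from `C`, and those into `K ⊗ C` come from elements of `K`,
    -- where `i` is injective.
    have hinj : Function.Injective (i.rTensor C) := hC.injective_of_hom _ fun φ hφ => by
      obtain ⟨k, rfl⟩ := hKu.2 φ
      rw [hmk] at hφ
      have : i k = 0 := hFu.1 (hφ.trans (map_zero _).symm)
      rw [(injective_iff_map_eq_zero i).1 hi k this, map_zero]
    have hex : Function.Exact (i.rTensor C) (p.rTensor C) := rTensor_exact C hip hp
    have hsurj : Function.Surjective (p.rTensor C) := LinearMap.rTensor_surjective C hp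
    refine ⟨⟨?_, fun φ => ?_⟩,
      ExtVanish.cokernel hinj hex hsurj hKe (hC.extVanish.flat_tensor F),
      ⟨_, ModuleCat.of R (F ⊗[R] C), i.rTensor C, p.rTensor C, hKr,
        ⟨F, hF, ⟨LinearEquiv.refl R _⟩⟩, hinj, hex, hsurj⟩,
      fun A B _ _ _ _ f g hf hfg hg =>
        rTensor_injective_of_flat_presentation hip hp hinj hf hfg hg⟩
    · rw [injective_iff_map_eq_zero]
      intro y hy
      obtain ⟨x, rfl⟩ := hp y
      rw [← hmk] at hy
      obtain ⟨χ, hχ⟩ := exists_comp_eq_of_exact hinj hex _ hy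
      obtain ⟨k, rfl⟩ := hKu.2 χ
      rw [hmk] at hχ
      rw [← hFu.1 hχ, hip.apply_apply_eq_zero]
    · obtain ⟨ψ, rfl⟩ := exists_lift_of_subsingleton_ext hinj hex hsurj (hKe 0) φ
      obtain ⟨x, rfl⟩ := hFu.2 ψ
      exact ⟨p x, (hmk p x).symm⟩

/-- `Hom(C, -)` turns finite `C`-flat resolutions into finite flat resolutions. -/
lemma HasResolution.hom (hC : IsSemidualizing R C) {n : ℕ} {M : ModuleCat.{u} R}
    (hM : HasResolution (cFlatModules R C) n M) :
    ExtVanish R C M ∧ HasResolution (flatModules R) n (ModuleCat.of R (C →ₗ[R] M)) := by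
  have := hC.finite
  have hbase : ∀ X : ModuleCat.{u} R, cFlatModules R C X →
      ExtVanish R C X ∧ Module.Flat R (C →ₗ[R] X) := by
    rintro X ⟨F, hF, ⟨e⟩⟩
    exact ⟨(hC.extVanish.flat_tensor F).of_equiv_right e.symm,
      Module.Flat.of_linearEquiv (LinearEquiv.congrRight e ≪≫ₗ
        (LinearEquiv.ofBijective _ (hC.unit_bijective F)).symm)⟩
  induction n generalizing M with
  | zero => exact hbase M hM
  | succ n ih =>
    obtain ⟨K, X, i, p, hK, hX, hi, hip, hp⟩ := hM
    obtain ⟨hKe, hKr⟩ := ih hK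
    have hex : Function.Exact (i.compRight R : (C →ₗ[R] K) →ₗ[R] C →ₗ[R] X)
        (p.compRight R : (C →ₗ[R] X) →ₗ[R] C →ₗ[R] M) := fun φ =>
      ⟨fun h => exists_comp_eq_of_exact hi hip φ h, by
        rintro ⟨χ, rfl⟩
        exact LinearMap.ext fun c => hip.apply_apply_eq_zero (χ c)⟩
    exact ⟨ExtVanish.cokernel hi hip hp hKe (hbase X hX).1, ModuleCat.of R (C →ₗ[R] K),
      ModuleCat.of R (C →ₗ[R] X), i.compRight R, p.compRight R, hKr, (hbase X hX).2,
      fun φ ψ h => LinearMap.ext fun c => hi (LinearMap.congr_fun h c), hex,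
      exists_lift_of_subsingleton_ext hi hip hp (hKe 0)⟩

/-- Every map `C → M` factors through evaluation. Hence evaluation is injective, as the unit at
`Hom(C, M)` is surjective. Its cokernel receives no nonzero map from `C`, since such maps lift to
`M` by the vanishing of Ext. -/
lemma HasResolution.homTensorEval_bijective (hC : IsSemidualizing R C) {n : ℕ} {M : Type u}
    [AddCommGroup M] [Module R M]
    (hM : HasResolution (flatModules R) n (ModuleCat.of R (C →ₗ[R] M))) :
    Function.Bijective (homTensorEval R C M) := by
  obtain ⟨hu, he, -, -⟩ := hM.auslander hC
  have hmk : ∀ φ : C →ₗ[R] M,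
      homTensorEval R C M ∘ₗ TensorProduct.mk R (C →ₗ[R] M) C φ = φ := fun φ =>
    LinearMap.ext fun c => homTensorEval_tmul M φ c
  have hinj : Function.Injective (homTensorEval R C M) := hC.injective_of_hom _ fun χ hχ => by
    obtain ⟨φ, rfl⟩ := hu.2 χ
    have : φ = 0 := (hmk φ).symm.trans hχ
    rw [this, map_zero]
  refine ⟨hinj, ?_⟩
  have := hC.subsingleton_of_hom (M ⧸ LinearMap.range (homTensorEval R C M)) fun f => by
    obtain ⟨g, rfl⟩ := exists_lift_of_subsingleton_ext hinj (LinearMap.exact_map_mkQ_range _)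
      (Submodule.mkQ_surjective _) (he 0) f
    rw [← hmk g, ← LinearMap.comp_assoc, LinearMap.range_mkQ_comp, LinearMap.zero_comp]
  rw [← LinearMap.range_eq_top]
  exact Submodule.Quotient.subsingleton_iff.1 this

/-- By the triangle identity, the unit tensored with `C` is inverse to the bijective evaluation. It
remains to descend from `- ⊗ C`, which detects zero modules. -/
lemma HasResolution.unit_bijective_of_hom (hC : IsSemidualizing R C) {n : ℕ} {M : Type u}
    [AddCommGroup M] [Module R M]
    (hM : HasResolution (flatModules R) n (ModuleCat.of R (C →ₗ[R] M ⊗[R] C))) :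
    Function.Bijective (TensorProduct.mk R M C) := by
  have hev := hM.homTensorEval_bijective hC
  obtain ⟨-, -, -, htor⟩ := hM.auslander hC
  have hid : homTensorEval R C (M ⊗[R] C) ∘ₗ (TensorProduct.mk R M C).rTensor C =
      LinearMap.id := by
    ext x c
    simp [homTensorEval_tmul]
  have hinj : Function.Injective ((TensorProduct.mk R M C).rTensor C) :=
    Function.LeftInverse.injective (LinearMap.congr_fun hid)
  have hsurj : Function.Surjective ((TensorProduct.mk R M C).rTensor C) := fun y =>
    ⟨homTensorEval R C _ y, hev.1 (LinearMap.congr_fun hid _)⟩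
  have hmk : Function.Surjective (TensorProduct.mk R M C) := by
    have hq := (TensorProduct.mk R M C).exact_map_mkQ_range
    have := hC.subsingleton_of_tensor
      ((C →ₗ[R] M ⊗[R] C) ⧸ LinearMap.range (TensorProduct.mk R M C)) (by
        refine subsingleton_of_forall_eq 0 fun y => ?_
        obtain ⟨x, rfl⟩ := LinearMap.rTensor_surjective C (Submodule.mkQ_surjective _) y
        obtain ⟨z, rfl⟩ := hsurj x
        rw [← LinearMap.comp_apply, ← LinearMap.rTensor_comp, hq.linearMap_comp_eq_zero,
          LinearMap.rTensor_zero, LinearMap.zero_apply])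
    rw [← LinearMap.range_eq_top]
    exact Submodule.Quotient.subsingleton_iff.1 this
  refine ⟨?_, hmk⟩
  have hk := (TensorProduct.mk R M C).exact_subtype_ker_map
  -- `htor` plays the role of vanishing of Tor: the kernel tensored with `C` still embeds in `M ⊗
  -- C`, where `hinj` forces it to be zero.
  have hKinj := htor _ _ _ _ (Submodule.injective_subtype _) hk hmk
  have := hC.subsingleton_of_tensor (LinearMap.ker (TensorProduct.mk R M C)) (by
    refine subsingleton_of_forall_eq 0 fun y => hKinj (hinj ?_)
    rw [map_zero, map_zero, ← LinearMap.comp_apply, ← LinearMap.rTensor_comp,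
      hk.linearMap_comp_eq_zero, LinearMap.rTensor_zero, LinearMap.zero_apply])
  exact LinearMap.ker_eq_bot.1 (Submodule.eq_bot_of_subsingleton)

end Semidualizing

/-! ### The adjunction, expressed through evaluation. -/

section

variable {R : Type u} [CommRing R] {C F W Y : Type u} [AddCommGroup C] [Module R C]
  [AddCommGroup F] [Module R F] [AddCommGroup W] [Module R W] [AddCommGroup Y] [Module R Y]

/-- The adjunction `Hom(F, Hom(C, M)) ≃ Hom(F ⊗ C, M)`, transported to `Y ≃ F ⊗ C`. -/
noncomputable def homHomEquiv (M : Type u) [AddCommGroup M] [Module R M] (e : Y ≃ₗ[R] F ⊗[R] C) :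
    (F →ₗ[R] C →ₗ[R] M) ≃ₗ[R] (Y →ₗ[R] M) :=
  TensorProduct.lift.equiv (.id R) F C M ≪≫ₗ LinearEquiv.congrLeft M R e.symm

lemma homHomEquiv_apply (M : Type u) [AddCommGroup M] [Module R M] (e : Y ≃ₗ[R] F ⊗[R] C)
    (f : F →ₗ[R] C →ₗ[R] M) :
    homHomEquiv M e f = homTensorEval R C M ∘ₗ f.rTensor C ∘ₗ e.toLinearMap := by
  have h : TensorProduct.lift.equiv (.id R) F C M f = homTensorEval R C M ∘ₗ f.rTensor C :=
    TensorProduct.ext' fun x c => by simp [homTensorEval_tmul]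
  change TensorProduct.lift.equiv (.id R) F C M f ∘ₗ e.toLinearMap = _
  rw [h, LinearMap.comp_assoc]

/-- Tensoring with `C` is bijective on maps into modules `W ≃ Hom(C, W ⊗ C)`. -/
noncomputable def homRTensorEquiv (hu : Function.Bijective (TensorProduct.mk R W C))
    (e : Y ≃ₗ[R] F ⊗[R] C) : (F →ₗ[R] W) ≃ₗ[R] (Y →ₗ[R] W ⊗[R] C) :=
  LinearEquiv.congrRight (LinearEquiv.ofBijective _ hu) ≪≫ₗ homHomEquiv _ e

lemma homRTensorEquiv_apply (hu : Function.Bijective (TensorProduct.mk R W C))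
    (e : Y ≃ₗ[R] F ⊗[R] C) (f : F →ₗ[R] W) :
    homRTensorEquiv hu e f = f.rTensor C ∘ₗ e.toLinearMap := by
  change homHomEquiv _ e (TensorProduct.mk R W C ∘ₗ f) = _
  rw [homHomEquiv_apply, ← LinearMap.comp_assoc]
  congr 1
  exact TensorProduct.ext' fun x c => by simp [homTensorEval_tmul]

end

/-! ### Transport of proper resolutions by `Hom(C, -)` and `- ⊗ C`. -/

namespace AugmentedComplex

variable {R : Type u} [CommRing R] {M : Type u} [AddCommGroup M] [Module R M]

/-- The complex `Hom(C, A)`. -/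
def homComplex (C : Type u) [AddCommGroup C] [Module R C] (A : AugmentedComplex R M) :
    AugmentedComplex R (C →ₗ[R] M) where
  X i := ModuleCat.of R (C →ₗ[R] A.X i)
  d i := (A.d i).compRight R
  aug := A.aug.compRight R
  d_comp_d i := LinearMap.ext fun φ => LinearMap.ext fun c =>
    LinearMap.congr_fun (A.d_comp_d i) (φ c)
  aug_comp_d := LinearMap.ext fun φ => LinearMap.ext fun c =>
    LinearMap.congr_fun A.aug_comp_d (φ c)

lemma IsHomExact.homComplex {C : Type u} [AddCommGroup C] [Module R C] {A : AugmentedComplex R M}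
    {Y : ModuleCat.{u} R} (hA : A.IsHomExact (ModuleCat.of R (Y ⊗[R] C))) :
    (A.homComplex C).IsHomExact Y :=
  hA.of_equiv (fun i => (TensorProduct.lift.equiv (.id R) Y C (A.X i)).symm.toAddEquiv)
    (TensorProduct.lift.equiv (.id R) Y C M).symm.toAddEquiv (fun _ _ => rfl) (fun _ => rfl)

/-- The complex `A ⊗ C`, augmented by evaluation, for a complex `A` augmented to `Hom(C, M)`. -/
noncomputable def tensorComplex {C : Type u} [AddCommGroup C] [Module R C]
    (A : AugmentedComplex R (C →ₗ[R] M)) : AugmentedComplex R M where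
  X i := ModuleCat.of R (A.X i ⊗[R] C)
  d i := (A.d i).rTensor C
  aug := homTensorEval R C M ∘ₗ A.aug.rTensor C
  d_comp_d i := by rw [← LinearMap.rTensor_comp, A.d_comp_d, LinearMap.rTensor_zero]
  aug_comp_d := by
    rw [LinearMap.comp_assoc, ← LinearMap.rTensor_comp, A.aug_comp_d, LinearMap.rTensor_zero,
      LinearMap.comp_zero]

lemma IsHomExact.tensorComplex {C : Type u} [AddCommGroup C] [Module R C]
    {A : AugmentedComplex R (C →ₗ[R] M)}
    (hu : ∀ i, Function.Bijective (TensorProduct.mk R (A.X i) C)) {F Y : ModuleCat.{u} R}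
    (e : Y ≃ₗ[R] F ⊗[R] C) (hA : A.IsHomExact F) : A.tensorComplex.IsHomExact Y := by
  refine hA.of_equiv (B := A.tensorComplex) (fun i => (homRTensorEquiv (hu i) e).toAddEquiv)
    (homHomEquiv M e).toAddEquiv (fun i f => ?_) (fun f => ?_)
  · change homRTensorEquiv (hu i) e (A.d i ∘ₗ f) =
      (A.d i).rTensor C ∘ₗ homRTensorEquiv (hu (i + 1)) e f
    rw [homRTensorEquiv_apply, homRTensorEquiv_apply, LinearMap.rTensor_comp,
      LinearMap.comp_assoc]
  · change homHomEquiv M e (A.aug ∘ₗ f) =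
      (homTensorEval R C M ∘ₗ A.aug.rTensor C) ∘ₗ homRTensorEquiv (hu 0) e f
    rw [homHomEquiv_apply, homRTensorEquiv_apply, LinearMap.rTensor_comp,
      LinearMap.comp_assoc, LinearMap.comp_assoc]

end AugmentedComplex

/-! ### Comparison of the dimensions. -/

section

variable {R : Type u} [CommRing R] [IsNoetherianRing R] {C : Type u} [AddCommGroup C] [Module R C]

lemma IsSemidualizing.flat_hom (hC : IsSemidualizing R C) {X : ModuleCat.{u} R}
    (hX : cFlatModules R C X) : Module.Flat R (C →ₗ[R] X) :=
  (HasResolution.hom (n := 0) hC hX).2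

/-- The `C`-flat dimension of `M` is the flat dimension of `Hom(C, M)`. -/
theorem cFlatProjDim_eq_flatDim_hom (hC : IsSemidualizing R C) (M : Type u) [AddCommGroup M]
    [Module R M] : cFlatProjDim R C M = flatDim R (C →ₗ[R] M) := by
  refine le_antisymm (le_iInf₂ fun A hA => ?_) (le_iInf₂ fun A hA => ?_)
  · refine iInf₂_le_of_le A.tensorComplex ⟨fun i => ⟨A.X i, hA.mem i, ⟨LinearEquiv.refl R _⟩⟩, ?_⟩
      (AugmentedComplex.length_le_of_nontrivial _ _ fun i hi => ?_)
    · rintro Y ⟨F, hF, ⟨e⟩⟩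
      refine AugmentedComplex.IsHomExact.tensorComplex (fun i => ?_) e (hA.isHomExact F hF)
      have : Module.Flat R (A.X i) := hA.mem i
      exact hC.unit_bijective (A.X i)
    · by_contra h
      rw [not_nontrivial_iff_subsingleton] at h
      exact not_subsingleton (A.tensorComplex.X i)
        (inferInstanceAs (Subsingleton (A.X i ⊗[R] C)))
  · refine iInf₂_le_of_le (A.homComplex C) ⟨fun i => hC.flat_hom (hA.mem i), fun Y hY => ?_⟩
      (AugmentedComplex.length_le_of_nontrivial _ _ fun i hi => ?_)
    · exact (hA.isHomExact _ ⟨Y, hY, ⟨LinearEquiv.refl R _⟩⟩).homComplex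
    · by_contra h
      rw [not_nontrivial_iff_subsingleton] at h
      exact not_subsingleton ((A.homComplex C).X i)
        (inferInstanceAs (Subsingleton (C →ₗ[R] A.X i)))

/-- Bounded `C`-flat dimension is detected by exact resolutions. -/
theorem cFlatProjDim_le_iff_hasResolution (hC : IsSemidualizing R C) (M : Type u)
    [AddCommGroup M] [Module R M] (n : ℕ) : cFlatProjDim R C M ≤ (n : WithBot ℕ∞) ↔
      HasResolution (cFlatModules R C) n (ModuleCat.of R M) := by
  rw [cFlatProjDim_eq_flatDim_hom hC, flatDim_le_iff_hasResolution]
  refine ⟨fun h => ?_, fun h => (h.hom hC).2⟩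
  exact (h.auslander hC).2.2.1.of_equiv cFlatModules_of_equiv
    (LinearEquiv.ofBijective _ (h.homTensorEval_bijective hC))

lemma exists_le_natCast_of_ne_top {x : WithBot ℕ∞} (hx : x ≠ ⊤) :
    ∃ n : ℕ, x ≤ (n : WithBot ℕ∞) := by
  induction x with
  | bot => exact ⟨0, bot_le⟩
  | coe x =>
    induction x with
    | top => exact absurd rfl hx
    | coe n => exact ⟨n, le_rfl⟩

lemma flatDim_hom_tensor (hC : IsSemidualizing R C) (M : Type u)
    [AddCommGroup M] [Module R M] : flatDim R (C →ₗ[R] M ⊗[R] C) = flatDim R M := by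
  have key : ∀ h : Function.Bijective (TensorProduct.mk R M C),
      flatDim R (C →ₗ[R] M ⊗[R] C) = flatDim R M := fun h =>
    (relProjDim_congr _ (LinearEquiv.ofBijective _ h)).symm
  -- Only a finite dimension on one side makes the unit bijective; if neither is finite, both sides
  -- equal `⊤`.
  by_cases h1 : flatDim R M = ⊤
  · by_cases h2 : flatDim R (C →ₗ[R] M ⊗[R] C) = ⊤
    · rw [h1, h2]
    · obtain ⟨n, hn⟩ := exists_le_natCast_of_ne_top h2
      exact key (((flatDim_le_iff_hasResolution _ n).1 hn).unit_bijective_of_hom hC)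
  · obtain ⟨n, hn⟩ := exists_le_natCast_of_ne_top h1
    exact key (((flatDim_le_iff_hasResolution _ n).1 hn).auslander hC).1

end

theorem mainTheorem6 (R : Type u) [CommRing R] [IsNoetherianRing R]
    (C : Type u) [AddCommGroup C] [Module R C] (hC : IsSemidualizing R C)
    (M : Type u) [AddCommGroup M] [Module R M] :
    (∀ n : ℕ, cFlatProjDim R C M ≤ (n : WithBot ℕ∞) ↔
      ∃ L : AugmentedComplex R M, L.IsExact ∧
        (∀ i : ℕ, i ≤ n → cFlatModules R C (L.X i)) ∧
        (∀ i : ℕ, n < i → Subsingleton (L.X i))) ∧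
    cFlatProjDim R C M = flatDim R (C →ₗ[R] M) ∧
    cFlatProjDim R C (C ⊗[R] M) = flatDim R M := by
  refine ⟨fun n => ?_, cFlatProjDim_eq_flatDim_hom hC M, ?_⟩
  · rw [cFlatProjDim_le_iff_hasResolution hC]
    refine ⟨fun h => HasResolution.exists_isExact h, ?_⟩
    rintro ⟨L, hL, hmem, hsub⟩
    exact hL.hasResolution cFlatModules_of_equiv hmem hsub
  · rw [cFlatProjDim_eq_flatDim_hom hC, ← flatDim_hom_tensor hC M]
    exact relProjDim_congr _ (LinearEquiv.congrRight (TensorProduct.comm R C M))
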